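/- Let $n\ge 0$ and let $\omega=\sum_i dx_i\wedge dy_i$ be the standard symplectic form on $\mathbb{R}^{2n}=\mathbb{R}^n\oplus\mathbb{R}^n$, with standard Euclidean inner product and complex structure $J(x,y)=(-y,x)$. Let $$\mathscr{A}(n)=\{S\in \mathrm{Gl}(2n,\mathbb{R}) : S^2=\mathbb{1},\ \omega(Sv,Sw)=-\omega(v,w)\ \text{for all } v,w\}$$ be the space of linear anti-symplectic involutions, with its smooth structure as a submanifold of the space of $2n\times 2n$ matrices. Let $\Lambda(n)$ be the Lagrangian Grassmannian, i.e. the set of Lagrangian subspaces of $\mathbb{R}^{2n}$ with the smooth structure given by the graph charts $\psi(\operatorname{graph} B)\mapsto B\in\mathrm{Sym}(n)$, where $\psi\in \mathrm{Sp}(n)$ and $\mathrm{Sym}(n)$ is the space of real symmetric $n\times n$ matrices. Then: 1. For $S\in\mathscr{A}(n)$ the Lagrangian subspaces $\mathrm{Fix}(S)$ and $\mathrm{Fix}(-S)$ are complementary, and for every pair $(L,M)$ of complementary Lagrangian subspaces there is exactly one $S\in\mathscr{A}(n)$ with $\mathrm{Fix}(S)=L$ and $\mathrm{Fix}(-S)=M$.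 2. There is a ($C^\infty$) diffeomorphism $\Phi:\mathscr{A}(n)\to T\Lambda(n)$ which covers the map $S\mapsto\mathrm{Fix}(S)$, i.e. $\Phi(S)\in T_{\mathrm{Fix}(S)}\Lambda(n)$ for all $S$. Moreover, for every $L\in\Lambda(n)$ and every orthonormal basis $u_1,\dots,u_n$ of $L$ there is a bijection $\sigma:\mathrm{Sym}(n)\to\{S\in\mathscr{A}(n):\mathrm{Fix}(S)=L\}$, smooth as a map into $\mathscr{A}(n)$, such that for every $B\in\mathrm{Sym}(n)$ the complementary Lagrangian $\mathrm{Fix}(-\sigma(B))$ is the graph of $B$ over $L^\perp=JL$ with respect to the bases $Ju_1,\dots,Ju_n$ of $L^\perp$ and $u_1,\dots,u_n$ of $L$, that is $$\mathrm{Fix}(-\sigma(B))=\Big\{\sum_{i}\big(y_i\,Ju_i+(By)_i\,u_i\big) : y\in\mathbb{R}^n\Big\},$$ and such that $\Phi\circ\sigma$ is a linear isomorphism from $\mathrm{Sym}(n)$ onto $T_L\Lambda(n)$. -/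

import Mathlib

open Set Matrix
open scoped Manifold ContDiff

attribute [local instance] Matrix.normedAddCommGroup Matrix.normedSpace

noncomputable section

/-- The vector space `ℝ²ⁿ = ℝⁿ ⊕ ℝⁿ`; the coordinates are `(x, y)` with `x i = v (inl i)` and
`y i = v (inr i)`. -/
abbrev StdSpace (n : ℕ) : Type := Fin n ⊕ Fin n → ℝ

/-- Real `2n × 2n` matrices, acting on `StdSpace n` by `*ᵥ`. -/
abbrev BigMat (n : ℕ) : Type := Matrix (Fin n ⊕ Fin n) (Fin n ⊕ Fin n) ℝ

/-- The standard symplectic form `ω = ∑ dxᵢ ∧ dyᵢ`. -/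
def stdOmega {n : ℕ} (v w : StdSpace n) : ℝ :=
  ∑ i, (v (Sum.inl i) * w (Sum.inr i) - v (Sum.inr i) * w (Sum.inl i))

/-- `L` is Lagrangian when it equals its own symplectic complement. -/
def IsLagrangian {n : ℕ} (L : Submodule ℝ (StdSpace n)) : Prop :=
  ∀ v, v ∈ L ↔ ∀ w ∈ L, stdOmega v w = 0

/-- The subspace of symmetric matrices in the space of real `n × n` matrices. -/
def symSubmodule (n : ℕ) : Submodule ℝ (Matrix (Fin n) (Fin n) ℝ) where
  carrier := {B | Bᵀ = B}
  add_mem' {a b} ha hb := by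
    simp only [mem_ofPred_eq, transpose_add] at *
    rw [ha, hb]
  zero_mem' := by simp
  smul_mem' c a ha := by
    simp only [mem_ofPred_eq, transpose_smul] at *
    rw [ha]

/-- The space `Sym(n)` of real symmetric `n × n` matrices, with the entrywise sup norm. -/
def SymMat (n : ℕ) : Type := symSubmodule n

instance instNormedAddCommGroupSymMat (n : ℕ) : NormedAddCommGroup (SymMat n) :=
  inferInstanceAs (NormedAddCommGroup (symSubmodule n))

instance instNormedSpaceSymMat (n : ℕ) : NormedSpace ℝ (SymMat n) :=
  inferInstanceAs (NormedSpace ℝ (symSubmodule n))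

/-- The matrix underlying an element of `Sym(n)`. -/
def SymMat.toMat {n : ℕ} : SymMat n →ₗ[ℝ] Matrix (Fin n) (Fin n) ℝ :=
  (symSubmodule n).subtype

theorem SymMat.transpose_toMat {n : ℕ} (B : SymMat n) : B.toMatᵀ = B.toMat := B.2

/-- A symmetric matrix as an element of `Sym(n)`. -/
def SymMat.mk {n : ℕ} (M : Matrix (Fin n) (Fin n) ℝ) (h : Mᵀ = M) : SymMat n := ⟨M, h⟩

theorem SymMat.ext {n : ℕ} {B C : SymMat n} (h : B.toMat = C.toMat) : B = C := Subtype.ext h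

/-- The Lagrangian Grassmannian: the set of all Lagrangian subspaces of `ℝ²ⁿ`. -/
@[ext]
structure LagGr (n : ℕ) : Type where
  carrier : Submodule ℝ (StdSpace n)
  isLagrangian : IsLagrangian carrier

/-- The set of linear anti-symplectic involutions of `ℝ²ⁿ`. (Invertibility is implied
by `S * S = 1`.) As a type it carries the subspace topology. -/
def AntiInv (n : ℕ) : Set (BigMat n) :=
  {S | S * S = 1 ∧ ∀ v w, stdOmega (S *ᵥ v) (S *ᵥ w) = -stdOmega v w}

/-- If `S` is an anti-symplectic involution, then so is `-S`. -/
instance instNegAntiInv (n : ℕ) : Neg (AntiInv n) where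
  neg S := ⟨-S.1, by simpa using S.2.1, by
    intro v w
    rw [← S.2.2 v w]
    simp [stdOmega, neg_mulVec]⟩

section Linear

variable {n : ℕ}

theorem stdOmega_eq (v w : StdSpace n) :
    stdOmega v w = -(v ⬝ᵥ (J (Fin n) ℝ *ᵥ w)) := by
  simp [stdOmega, dotProduct, Matrix.J, fromBlocks_mulVec, Fintype.sum_sum_type, neg_mulVec,
    Finset.sum_sub_distrib]
  ring

theorem stdOmega_add_left (u v w : StdSpace n) :
    stdOmega (u + v) w = stdOmega u w + stdOmega v w := by
  simp [stdOmega_eq, add_dotProduct]; ring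

theorem stdOmega_add_right (u v w : StdSpace n) :
    stdOmega u (v + w) = stdOmega u v + stdOmega u w := by
  simp [stdOmega_eq, mulVec_add]; ring

theorem stdOmega_mulVec (A : BigMat n) (v w : StdSpace n) :
    stdOmega (A *ᵥ v) (A *ᵥ w) = -(v ⬝ᵥ ((Aᵀ * J (Fin n) ℝ * A) *ᵥ w)) := by
  rw [stdOmega_eq, ← mulVec_mulVec, ← mulVec_mulVec, dotProduct_comm, dotProduct_mulVec,
    ← mulVec_transpose, dotProduct_comm]

theorem eq_zero_of_stdOmega (v : StdSpace n) (h : ∀ w, stdOmega v w = 0) : v = 0 := by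
  have h1 : ∀ w, v ⬝ᵥ w = 0 := by
    intro w
    have := h (J (Fin n) ℝ *ᵥ w)
    rw [stdOmega_eq, mulVec_mulVec, J_squared] at this
    simpa [neg_mulVec] using this
  exact dotProduct_self_eq_zero.mp (h1 v)

theorem matrix_ext_dotProduct {A B : BigMat n} (h : ∀ v w, v ⬝ᵥ (A *ᵥ w) = v ⬝ᵥ (B *ᵥ w)) :
    A = B := by
  ext i j
  simpa using h (Pi.single i 1) (Pi.single j 1)

theorem antiInv_iff (S : BigMat n) :
    S ∈ AntiInv n ↔ S * S = 1 ∧ Sᵀ * J (Fin n) ℝ * S = -J (Fin n) ℝ := by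
  refine and_congr_right fun _ => ⟨fun h => ?_, fun h v w => ?_⟩
  · apply matrix_ext_dotProduct
    intro v w
    have := h v w
    rw [stdOmega_mulVec, stdOmega_eq] at this
    simp only [neg_mulVec, dotProduct_neg]
    linarith
  · rw [stdOmega_mulVec, h, stdOmega_eq]
    simp [neg_mulVec]

theorem stdOmega_symplectic (ψ : symplecticGroup (Fin n) ℝ) (v w : StdSpace n) :
    stdOmega (ψ.1 *ᵥ v) (ψ.1 *ᵥ w) = stdOmega v w := by
  rw [stdOmega_mulVec, SymplecticGroup.mem_iff'.mp ψ.2, stdOmega_eq]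

theorem symp_mul_inv (ψ : symplecticGroup (Fin n) ℝ) : ψ.1 * (ψ⁻¹).1 = 1 :=
  congrArg Subtype.val (mul_inv_cancel ψ)

theorem symp_inv_mul (ψ : symplecticGroup (Fin n) ℝ) : (ψ⁻¹).1 * ψ.1 = 1 :=
  congrArg Subtype.val (inv_mul_cancel ψ)

theorem IsLagrangian.map_symplectic {L : Submodule ℝ (StdSpace n)} (hL : IsLagrangian L)
    (ψ : symplecticGroup (Fin n) ℝ) : IsLagrangian (L.map ψ.1.mulVecLin) := by
  have key : ∀ v, v ∈ L.map ψ.1.mulVecLin ↔ (ψ⁻¹).1 *ᵥ v ∈ L := by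
    intro v
    constructor
    · rintro ⟨x, hx, rfl⟩
      simpa [mulVec_mulVec, symp_inv_mul] using hx
    · intro h
      exact ⟨_, h, by simp [mulVec_mulVec, symp_mul_inv]⟩
  intro v
  rw [key, hL]
  constructor
  · intro h w hw
    rw [← stdOmega_symplectic ψ⁻¹]
    exact h _ ((key w).mp hw)
  · intro h w hw
    rw [← stdOmega_symplectic ψ, mulVec_mulVec, symp_mul_inv, one_mulVec]
    exact h _ ⟨w, hw, rfl⟩

theorem IsLagrangian.eq_of_le {L M : Submodule ℝ (StdSpace n)} (hL : IsLagrangian L)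
    (hM : IsLagrangian M) (h : L ≤ M) : L = M :=
  le_antisymm h fun v hv => (hL v).mpr fun w hw => (hM v).mp hv w (h hw)

end Linear

/-- The Lagrangian subspace `Fix(S) = {v | S v = v}`, for an anti-symplectic involution `S`. -/
def fixSpace {n : ℕ} (S : AntiInv n) : LagGr n where
  carrier := LinearMap.eqLocus S.1.mulVecLin LinearMap.id
  isLagrangian := by
    have hS : ∀ v, S.1 *ᵥ (S.1 *ᵥ v) = v := fun v => by
      rw [mulVec_mulVec, S.2.1, one_mulVec]
    intro v
    simp only [LinearMap.mem_eqLocus, mulVecLin_apply, LinearMap.id_apply]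
    constructor
    · intro hv w hw
      have := S.2.2 v w
      rw [hv, hw] at this
      linarith
    · intro h
      have h2 : v - S.1 *ᵥ v = 0 := by
        apply eq_zero_of_stdOmega
        intro w
        have h3 := h (w + S.1 *ᵥ w) (by rw [mulVec_add, hS, add_comm])
        have h4 := S.2.2 v w
        have h5 := S.2.2 v (S.1 *ᵥ w)
        rw [hS] at h5
        rw [stdOmega_add_right] at h3
        have h6 : stdOmega (v - S.1 *ᵥ v) w = stdOmega v w - stdOmega (S.1 *ᵥ v) w := by
          simp [stdOmega_eq, sub_dotProduct]; ring
        rw [h6]; linarith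
      exact (sub_eq_zero.mp h2).symm

/-- The graph `{(x, B x) | x ∈ ℝⁿ}` of a symmetric matrix `B`. -/
def stdGraph {n : ℕ} (B : SymMat n) : LagGr n where
  carrier :=
    { carrier := {v | (fun i => v (Sum.inr i)) = B.toMat *ᵥ fun i => v (Sum.inl i)}
      add_mem' := by
        intro a b ha hb
        simp only [mem_ofPred_eq] at *
        have : (fun i => (a + b) (Sum.inl i)) = (fun i => a (Sum.inl i)) + fun i => b (Sum.inl i) :=
          rfl
        rw [this, mulVec_add, ← ha, ← hb]; rfl
      zero_mem' := by
        have : (fun i => (0 : StdSpace n) (Sum.inl i)) = (0 : Fin n → ℝ) := rfl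
        simp only [mem_ofPred_eq]
        rw [this, mulVec_zero]; rfl
      smul_mem' := by
        intro c a ha
        simp only [mem_ofPred_eq] at *
        have : (fun i => (c • a) (Sum.inl i)) = c • (fun i => a (Sum.inl i)) := rfl
        rw [this, mulVec_smul, ← ha]; rfl }
  isLagrangian := by
    have hom : ∀ v w : StdSpace n, stdOmega v w =
        (fun i => v (Sum.inl i)) ⬝ᵥ (fun i => w (Sum.inr i)) -
          (fun i => v (Sum.inr i)) ⬝ᵥ (fun i => w (Sum.inl i)) := by
      intro v w
      simp [stdOmega, dotProduct]
    have hB : ∀ x y : Fin n → ℝ, x ⬝ᵥ (B.toMat *ᵥ y) = (B.toMat *ᵥ x) ⬝ᵥ y := by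
      intro x y
      have h : B.toMatᵀ = B.toMat := B.transpose_toMat
      rw [dotProduct_mulVec, ← mulVec_transpose, h]
    intro v
    simp only [Submodule.mem_mk, AddSubmonoid.mem_mk, AddSubsemigroup.mem_mk, mem_ofPred_eq]
    constructor
    · intro hv w hw
      rw [hom, hv, hw, hB, sub_self]
    · intro h
      have h1 : ∀ x : Fin n → ℝ,
          ((B.toMat *ᵥ fun i => v (Sum.inl i)) - fun i => v (Sum.inr i)) ⬝ᵥ x = 0 := by
        intro x
        have := h (Sum.elim x (B.toMat *ᵥ x)) rfl
        rw [hom] at this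
        simp only [Sum.elim_inl, Sum.elim_inr] at this
        rw [sub_dotProduct, ← hB]
        exact this
      exact (sub_eq_zero.mp (dotProduct_self_eq_zero.mp (h1 _))).symm

/-- The image `ψ(L)` of a Lagrangian subspace under a linear symplectic map. -/
def sympImage {n : ℕ} (ψ : symplecticGroup (Fin n) ℝ) (L : LagGr n) : LagGr n where
  carrier := L.carrier.map ψ.1.mulVecLin
  isLagrangian := L.isLagrangian.map_symplectic ψ

section Symplectic

variable {n : ℕ}

theorem isLagrangian_finrank {L : Submodule ℝ (StdSpace n)} (hL : IsLagrangian L) :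
    Module.finrank ℝ L = n := by
  let β : LinearMap.BilinForm ℝ (StdSpace n) := Matrix.toBilin' (J (Fin n) ℝ)
  have hβ : ∀ v w, β v w = -stdOmega v w := by
    intro v w
    simp [β, stdOmega_eq, Matrix.toBilin'_apply']
  have hnd : β.Nondegenerate :=
    LinearMap.BilinForm.nondegenerate_toBilin'_of_det_ne_zero' _ (isUnit_det_J (Fin n) ℝ).ne_zero
  have anti : ∀ v w : StdSpace n, stdOmega v w = -stdOmega w v := by
    intro v w
    simp only [stdOmega, ← Finset.sum_neg_distrib]
    exact Finset.sum_congr rfl fun i _ => by ring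
  have hrefl : β.IsRefl := by
    intro v w h
    rw [hβ] at h ⊢
    rw [anti]; linarith
  have h1 := LinearMap.BilinForm.finrank_orthogonal hnd L
  have h2 : β.orthogonal L = L := by
    ext v
    rw [LinearMap.BilinForm.mem_orthogonal_iff, hL v]
    refine forall₂_congr fun w _ => ?_
    change β w v = 0 ↔ _
    rw [hβ, anti, neg_neg]
  rw [h2] at h1
  have h3 : Module.finrank ℝ (StdSpace n) = n + n := by simp
  have h4 := Submodule.finrank_le L
  omega

theorem exists_orthonormal_frame (L : LagGr n) :
    ∃ u : Fin n → StdSpace n, (∀ i, u i ∈ L.carrier) ∧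
      ∀ i j, u i ⬝ᵥ u j = if i = j then 1 else 0 := by
  let e := (WithLp.linearEquiv 2 ℝ (StdSpace n)).symm
  let L' : Submodule ℝ (EuclideanSpace ℝ (Fin n ⊕ Fin n)) := L.carrier.map e.toLinearMap
  have hr : Module.finrank ℝ L' = n :=
    (LinearEquiv.finrank_map_eq e L.carrier).trans (isLagrangian_finrank L.isLagrangian)
  let b := (stdOrthonormalBasis ℝ L').reindex (finCongr hr)
  refine ⟨fun i => WithLp.ofLp (b i : EuclideanSpace ℝ (Fin n ⊕ Fin n)), fun i => ?_, ?_⟩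
  · obtain ⟨x, hx, hx'⟩ := (b i).2
    have : WithLp.ofLp (b i : EuclideanSpace ℝ (Fin n ⊕ Fin n)) = x := by
      rw [← hx']; rfl
    change WithLp.ofLp (b i : EuclideanSpace ℝ (Fin n ⊕ Fin n)) ∈ L.carrier
    rw [this]; exact hx
  · intro i j
    have := orthonormal_iff_ite.mp b.orthonormal i j
    rw [← this, Submodule.coe_inner, EuclideanSpace.inner_eq_star_dotProduct]
    simp [dotProduct_comm]

theorem symplectic_fromBlocks_iff (p q r s : Matrix (Fin n) (Fin n) ℝ) :
    fromBlocks p q r s ∈ symplecticGroup (Fin n) ℝ ↔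
      rᵀ * p = pᵀ * r ∧ pᵀ * s - rᵀ * q = 1 ∧ sᵀ * q = qᵀ * s := by
  rw [SymplecticGroup.mem_iff', Matrix.J, fromBlocks_transpose, fromBlocks_multiply,
    fromBlocks_multiply, fromBlocks_inj]
  simp only [Matrix.mul_zero, Matrix.mul_one, Matrix.mul_neg, zero_add, add_zero, Matrix.neg_mul,
    ← sub_eq_add_neg]
  constructor
  · rintro ⟨h1, h2, -, h4⟩
    refine ⟨sub_eq_zero.mp h1, ?_, sub_eq_zero.mp h4⟩
    rw [← neg_inj, neg_sub]; exact h2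
  · rintro ⟨h1, h2, h4⟩
    refine ⟨sub_eq_zero.mpr h1, ?_, ?_, sub_eq_zero.mpr h4⟩
    · rw [← h2, neg_sub]
    · have := congrArg Matrix.transpose h2
      simpa using this

theorem exists_symp_of_lagrangian (L : LagGr n) :
    ∃ ψ : symplecticGroup (Fin n) ℝ, sympImage ψ (stdGraph 0) = L := by
  obtain ⟨u, hu, ho⟩ := exists_orthonormal_frame L
  let P : Matrix (Fin n) (Fin n) ℝ := Matrix.of fun i j => u j (Sum.inl i)
  let Q : Matrix (Fin n) (Fin n) ℝ := Matrix.of fun i j => u j (Sum.inr i)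
  have h1 : Pᵀ * P + Qᵀ * Q = 1 := by
    ext i j
    have := ho i j
    simpa [Matrix.mul_apply, P, Q, dotProduct, Fintype.sum_sum_type, Matrix.one_apply] using this
  have h2 : Qᵀ * P = Pᵀ * Q := by
    ext i j
    have := (L.isLagrangian (u i)).mp (hu i) (u j) (hu j)
    simp only [stdOmega, Finset.sum_sub_distrib] at this
    simp only [Matrix.mul_apply, P, Q, transpose_apply, of_apply]
    linarith
  have hm : fromBlocks P (-Q) Q P ∈ symplecticGroup (Fin n) ℝ := by
    rw [symplectic_fromBlocks_iff]
    refine ⟨h2, ?_, ?_⟩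
    · simpa using h1
    · simp [h2]
  refine ⟨⟨_, hm⟩, LagGr.ext (IsLagrangian.eq_of_le (sympImage _ _).isLagrangian L.isLagrangian ?_)⟩
  rintro _ ⟨v, hv, rfl⟩
  have hv' : (fun i => v (Sum.inr i)) = 0 := by
    have : (fun i => v (Sum.inr i)) = (0 : Matrix (Fin n) (Fin n) ℝ) *ᵥ fun i => v (Sum.inl i) := hv
    simpa using this
  have hsum : (fromBlocks P (-Q) Q P).mulVecLin v = ∑ j, v (Sum.inl j) • u j := by
    ext k
    have hz : ∀ i, v (Sum.inr i) = 0 := fun i => congrFun hv' i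
    rcases k with k | k <;>
      simp [mulVec, dotProduct, Fintype.sum_sum_type, hz, P, Q, mul_comm]
  rw [hsum]
  exact L.carrier.sum_mem fun j _ => L.carrier.smul_mem _ (hu j)

end Symplectic

section Smooth

variable {E : Type*} [NormedAddCommGroup E] [NormedSpace ℝ E] {s : Set E}
variable {k l m : Type*} [Fintype k] [Fintype l] [Fintype m]

theorem contDiffOn_matrix {f : E → Matrix k l ℝ} :
    ContDiffOn ℝ ∞ f s ↔ ∀ i j, ContDiffOn ℝ ∞ (fun x => f x i j) s := by
  have h1 : ContDiffOn ℝ ∞ f s ↔ ∀ i, ContDiffOn ℝ ∞ (fun x => f x i) s :=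
    contDiffOn_pi (F' := fun _ => l → ℝ)
  rw [h1]
  exact forall_congr' fun i => contDiffOn_pi

theorem contDiffOn_matrix_mul {f : E → Matrix k l ℝ} {g : E → Matrix l m ℝ}
    (hf : ContDiffOn ℝ ∞ f s) (hg : ContDiffOn ℝ ∞ g s) :
    ContDiffOn ℝ ∞ (fun x => f x * g x) s := by
  rw [contDiffOn_matrix] at *
  intro i j
  simp only [Matrix.mul_apply]
  exact ContDiffOn.sum fun a _ => (hf i a).mul (hg a j)

theorem contDiffOn_matrix_det [DecidableEq k] {f : E → Matrix k k ℝ} (hf : ContDiffOn ℝ ∞ f s) :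
    ContDiffOn ℝ ∞ (fun x => (f x).det) s := by
  rw [contDiffOn_matrix] at hf
  simp only [Matrix.det_apply]
  exact ContDiffOn.sum fun σ _ => (contDiffOn_prod fun i _ => hf _ _).const_smul _

theorem contDiffOn_matrix_inv [DecidableEq k] {f : E → Matrix k k ℝ} (hf : ContDiffOn ℝ ∞ f s)
    (h : ∀ x ∈ s, (f x).det ≠ 0) : ContDiffOn ℝ ∞ (fun x => (f x)⁻¹) s := by
  have hd := contDiffOn_matrix_det hf
  rw [contDiffOn_matrix] at hf ⊢
  intro i j
  simp only [Matrix.inv_def, Ring.inverse_eq_inv', Matrix.smul_apply, Matrix.adjugate_apply,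
    smul_eq_mul]
  refine (hd.inv h).mul (contDiffOn_matrix_det ?_)
  rw [contDiffOn_matrix]
  intro a b
  by_cases hab : a = j
  · subst hab
    simpa using contDiffOn_const
  · simpa [Matrix.updateRow_ne hab] using hf a b

theorem SymMat.contDiff_toMat {n : ℕ} : ContDiff ℝ ∞ (SymMat.toMat (n := n)) :=
  (symSubmodule n).subtypeL.contDiff

theorem contDiffOn_symMat {n : ℕ} {f : E → SymMat n} :
    ContDiffOn ℝ ∞ f s ↔ ContDiffOn ℝ ∞ (fun x => (f x).toMat) s := by
  constructor
  · intro h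
    exact SymMat.contDiff_toMat.comp_contDiffOn h
  · intro h
    obtain ⟨p, hp⟩ := LinearMap.exists_leftInverse_of_injective (SymMat.toMat (n := n))
      (Submodule.ker_subtype _)
    have h1 := (LinearMap.toContinuousLinearMap p).contDiff (n := ∞) |>.comp_contDiffOn h
    refine h1.congr fun x _ => ?_
    exact (LinearMap.congr_fun hp (f x)).symm

end Smooth

section LagrangianGrassmannian

variable {n : ℕ}

/-- The parametrisation `B ↦ ψ(graph B)` of the set of Lagrangian subspaces that are
transverse to `ψ(0 ⊕ ℝⁿ)`. -/
def lagParam (ψ : symplecticGroup (Fin n) ℝ) (B : SymMat n) : LagGr n :=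
  sympImage ψ (stdGraph B)

theorem sympImage_mul (ψ φ : symplecticGroup (Fin n) ℝ) (L : LagGr n) :
    sympImage (ψ * φ) L = sympImage ψ (sympImage φ L) := by
  ext1
  simp [sympImage, ← Submodule.map_comp, Matrix.mulVecLin_mul]

theorem sympImage_one (L : LagGr n) : sympImage 1 L = L := by
  ext1
  simp [sympImage]

theorem mem_stdGraph (B : SymMat n) (v : StdSpace n) :
    v ∈ (stdGraph B).carrier ↔ (fun i => v (Sum.inr i)) = B.toMat *ᵥ fun i => v (Sum.inl i) := Iff.rfl

theorem sympImage_stdGraph_eq (θ : symplecticGroup (Fin n) ℝ) (B C : SymMat n) :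
    sympImage θ (stdGraph B) = stdGraph C ↔
      θ.1.toBlocks₂₁ + θ.1.toBlocks₂₂ * B.toMat = C.toMat * (θ.1.toBlocks₁₁ + θ.1.toBlocks₁₂ * B.toMat) := by
  have hθ : ∀ x : Fin n → ℝ, θ.1 *ᵥ Sum.elim x (B.toMat *ᵥ x) =
      Sum.elim ((θ.1.toBlocks₁₁ + θ.1.toBlocks₁₂ * B.toMat) *ᵥ x)
        ((θ.1.toBlocks₂₁ + θ.1.toBlocks₂₂ * B.toMat) *ᵥ x) := by
    intro x
    conv_lhs => rw [← fromBlocks_toBlocks θ.1]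
    rw [fromBlocks_mulVec]
    simp [add_mulVec, mulVec_mulVec, Function.comp_def]
  have hmem : ∀ v, v ∈ (stdGraph B).carrier → v = Sum.elim (fun i => v (Sum.inl i))
      (B.toMat *ᵥ fun i => v (Sum.inl i)) := by
    intro v hv
    rw [← (mem_stdGraph B v).mp hv]
    ext (i | i) <;> rfl
  constructor
  · intro h
    refine ext_of_mulVec_single fun i => ?_
    have h1 : θ.1 *ᵥ Sum.elim (Pi.single i 1) (B.toMat *ᵥ Pi.single i 1) ∈ (stdGraph C).carrier := by
      rw [← h]
      exact ⟨_, rfl, rfl⟩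
    rw [hθ, mem_stdGraph] at h1
    simp only [Sum.elim_inl, Sum.elim_inr] at h1
    rw [← mulVec_mulVec]
    exact h1
  · intro h
    refine LagGr.ext (IsLagrangian.eq_of_le (sympImage _ _).isLagrangian
      (stdGraph C).isLagrangian ?_)
    rintro _ ⟨v, hv, rfl⟩
    rw [hmem v hv, mulVecLin_apply, hθ, mem_stdGraph]
    simp only [Sum.elim_inl, Sum.elim_inr]
    rw [h, ← mulVec_mulVec]

theorem stdGraph_injective : Function.Injective (stdGraph (n := n)) := by
  intro B C h
  have := (sympImage_stdGraph_eq 1 B C).mp (by rw [sympImage_one, h])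
  have h1 : (1 : BigMat n) = fromBlocks 1 0 0 1 := fromBlocks_one.symm
  have h2 : (1 : BigMat n).toBlocks₁₁ = 1 := by rw [h1, toBlocks_fromBlocks₁₁]
  have h3 : (1 : BigMat n).toBlocks₁₂ = 0 := by rw [h1, toBlocks_fromBlocks₁₂]
  have h4 : (1 : BigMat n).toBlocks₂₁ = 0 := by rw [h1, toBlocks_fromBlocks₂₁]
  have h5 : (1 : BigMat n).toBlocks₂₂ = 1 := by rw [h1, toBlocks_fromBlocks₂₂]
  rw [Submonoid.coe_one, h2, h3, h4, h5] at this
  apply SymMat.ext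
  simpa using this

theorem lagParam_eq_iff (ψ φ : symplecticGroup (Fin n) ℝ) (B C : SymMat n) :
    lagParam ψ B = lagParam φ C ↔ sympImage (φ⁻¹ * ψ) (stdGraph B) = stdGraph C := by
  unfold lagParam
  constructor
  · intro h
    rw [sympImage_mul, h, ← sympImage_mul, inv_mul_cancel, sympImage_one]
  · intro h
    rw [← h, ← sympImage_mul, mul_inv_cancel_left]

theorem lagParam_injective (ψ : symplecticGroup (Fin n) ℝ) :
    Function.Injective (lagParam ψ) := by
  intro B C h
  rw [lagParam_eq_iff, inv_mul_cancel, sympImage_one] at h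
  exact stdGraph_injective h

/-- The graph chart of the Lagrangian Grassmannian given by `ψ`: its domain is the set of Lagrangian
subspaces of the form `ψ(graph B)`, and it sends `ψ(graph B)` to `B`. -/
def lagChart (ψ : symplecticGroup (Fin n) ℝ) : PartialEquiv (LagGr n) (SymMat n) where
  toFun := Function.invFun (lagParam ψ)
  invFun := lagParam ψ
  source := Set.range (lagParam ψ)
  target := Set.univ
  map_source' _ _ := mem_univ _
  map_target' _ _ := mem_range_self _
  left_inv' := by
    rintro _ ⟨B, rfl⟩
    rw [Function.leftInverse_invFun (lagParam_injective ψ)]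
  right_inv' B _ := Function.leftInverse_invFun (lagParam_injective ψ) B

theorem lagTransition_source (ψ φ : symplecticGroup (Fin n) ℝ) :
    ((lagChart ψ).symm.trans (lagChart φ)).source =
      {B | ((φ⁻¹ * ψ).1.toBlocks₁₁ + (φ⁻¹ * ψ).1.toBlocks₁₂ * B.toMat).det ≠ 0} := by
  have h0 : ((lagChart ψ).symm.trans (lagChart φ)).source =
      {B | ∃ C, sympImage (φ⁻¹ * ψ) (stdGraph B) = stdGraph C} := by
    ext B
    simp only [PartialEquiv.trans_source, PartialEquiv.symm_source, lagChart,
      mem_inter_iff, mem_univ, true_and, mem_preimage, mem_range, mem_ofPred_eq,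
      ← lagParam_eq_iff]
    exact exists_congr fun C => eq_comm
  rw [h0]
  generalize φ⁻¹ * ψ = θ
  ext B
  simp only [mem_ofPred_eq, sympImage_stdGraph_eq]
  set p := θ.1.toBlocks₁₁ + θ.1.toBlocks₁₂ * B.toMat with hp
  set r := θ.1.toBlocks₂₁ + θ.1.toBlocks₂₂ * B.toMat with hr
  have hU : fromBlocks 1 0 B.toMat 1 ∈ symplecticGroup (Fin n) ℝ := by
    rw [symplectic_fromBlocks_iff]
    have : B.toMatᵀ = B.toMat := B.transpose_toMat
    simp [this]
  have hX : fromBlocks p θ.1.toBlocks₁₂ r θ.1.toBlocks₂₂ ∈ symplecticGroup (Fin n) ℝ := by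
    have h := mul_mem θ.2 hU
    rw [← fromBlocks_toBlocks θ.1, fromBlocks_multiply] at h
    simpa [hp, hr] using h
  have h1 := (symplectic_fromBlocks_iff _ _ _ _).mp hX
  constructor
  · rintro ⟨C, hC⟩ hdet
    obtain ⟨x, hx, hx'⟩ := exists_mulVec_eq_zero_iff.mpr hdet
    have hrx : r *ᵥ x = 0 := by rw [hC, ← mulVec_mulVec, hx', mulVec_zero]
    have hpt : (θ.1.toBlocks₂₂ᵀ * p - θ.1.toBlocks₁₂ᵀ * r) = 1 := by
      have := congrArg Matrix.transpose h1.2.1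
      simpa using this
    apply hx
    rw [← one_mulVec x, ← hpt, sub_mulVec, ← mulVec_mulVec, ← mulVec_mulVec, hx', hrx]
    simp
  · intro hdet
    have hu : IsUnit p.det := isUnit_iff_ne_zero.mpr hdet
    refine ⟨SymMat.mk (r * p⁻¹) ?_, ?_⟩
    · have hut : IsUnit pᵀ.det := by rwa [det_transpose]
      have h2 : rᵀ = pᵀ * r * p⁻¹ := by
        rw [← h1.1, Matrix.mul_assoc, mul_nonsing_inv _ hu, Matrix.mul_one]
      rw [transpose_mul, transpose_nonsing_inv, h2, ← Matrix.mul_assoc, ← Matrix.mul_assoc,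
        nonsing_inv_mul _ hut, Matrix.one_mul]
    · change r = r * p⁻¹ * p
      rw [Matrix.mul_assoc, nonsing_inv_mul _ hu, Matrix.mul_one]

theorem lagTransition_contDiffOn (ψ φ : symplecticGroup (Fin n) ℝ) :
    ContDiffOn ℝ ∞ ((lagChart ψ).symm.trans (lagChart φ))
      ((lagChart ψ).symm.trans (lagChart φ)).source := by
  have hB : ContDiffOn ℝ ∞ (fun B : SymMat n => B.toMat)
      ((lagChart ψ).symm.trans (lagChart φ)).source :=
    SymMat.contDiff_toMat.contDiffOn
  have hp : ContDiffOn ℝ ∞ (fun B : SymMat n =>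
      (φ⁻¹ * ψ).1.toBlocks₁₁ + (φ⁻¹ * ψ).1.toBlocks₁₂ * B.toMat)
      ((lagChart ψ).symm.trans (lagChart φ)).source :=
    contDiffOn_const.add (contDiffOn_matrix_mul contDiffOn_const hB)
  have hr : ContDiffOn ℝ ∞ (fun B : SymMat n =>
      (φ⁻¹ * ψ).1.toBlocks₂₁ + (φ⁻¹ * ψ).1.toBlocks₂₂ * B.toMat)
      ((lagChart ψ).symm.trans (lagChart φ)).source :=
    contDiffOn_const.add (contDiffOn_matrix_mul contDiffOn_const hB)
  rw [contDiffOn_symMat]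
  refine (contDiffOn_matrix_mul hr (contDiffOn_matrix_inv hp ?_)).congr ?_
  · intro B hB
    rwa [lagTransition_source] at hB
  · intro B hB
    have hB2 := hB
    rw [lagTransition_source] at hB2
    have h1 : lagParam φ (((lagChart ψ).symm.trans (lagChart φ)) B) = lagParam ψ B := by
      have := hB.2
      exact (lagChart φ).left_inv this
    have h2 := (sympImage_stdGraph_eq _ _ _).mp ((lagParam_eq_iff _ _ _ _).mp h1.symm)
    rw [h2, Matrix.mul_assoc, mul_nonsing_inv _ (isUnit_iff_ne_zero.mpr hB2), Matrix.mul_one]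

/-- The graph charts form an atlas on the Lagrangian Grassmannian. -/
def lagChartedSpaceCore (n : ℕ) : ChartedSpaceCore (SymMat n) (LagGr n) where
  atlas := Set.range lagChart
  chartAt L := lagChart (exists_symp_of_lagrangian L).choose
  mem_chart_source L := ⟨0, (exists_symp_of_lagrangian L).choose_spec⟩
  chart_mem_atlas _ := mem_range_self _
  open_source := by
    rintro _ _ ⟨ψ, rfl⟩ ⟨φ, rfl⟩
    rw [lagTransition_source]
    refine isOpen_ne_fun (Continuous.matrix_det ?_) continuous_const
    exact continuous_const.add (continuous_const.matrix_mul SymMat.contDiff_toMat.continuous)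
  continuousOn_toFun := by
    rintro _ _ ⟨ψ, rfl⟩ ⟨φ, rfl⟩
    exact (lagTransition_contDiffOn ψ φ).continuousOn

/-- The topology of the Lagrangian Grassmannian, for which the graph charts are homeomorphisms
from open sets onto `Sym(n)`. -/
instance instTopologicalSpaceLagGr (n : ℕ) : TopologicalSpace (LagGr n) :=
  (lagChartedSpaceCore n).toTopologicalSpace

instance instChartedSpaceLagGr (n : ℕ) : ChartedSpace (SymMat n) (LagGr n) :=
  (lagChartedSpaceCore n).toChartedSpace

instance instIsManifoldLagGr (n : ℕ) : IsManifold 𝓘(ℝ, SymMat n) ∞ (LagGr n) := by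
  apply isManifold_of_contDiffOn
  intro e e' he he'
  change e ∈ ⋃ (e : PartialEquiv _ _) (he : e ∈ (lagChartedSpaceCore n).atlas),
    {(lagChartedSpaceCore n).openPartialHomeomorph e he} at he
  change e' ∈ ⋃ (e : PartialEquiv _ _) (he : e ∈ (lagChartedSpaceCore n).atlas),
    {(lagChartedSpaceCore n).openPartialHomeomorph e he} at he'
  simp only [mem_iUnion, mem_singleton_iff] at he he'
  obtain ⟨_, ⟨ψ, rfl⟩, rfl⟩ := he
  obtain ⟨_, ⟨φ, rfl⟩, rfl⟩ := he'
  have h := lagTransition_contDiffOn ψ φ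
  simp only [modelWithCornersSelf_coe, modelWithCornersSelf_coe_symm, range_id, inter_univ,
    preimage_id, Function.comp_id, Function.id_comp]
  exact h

end LagrangianGrassmannian

section AntiSymplecticInvolutions

variable {n : ℕ}

/-- The conjugate `ψ S ψ⁻¹` of an anti-symplectic involution by a linear symplectic map. -/
def sympConj (ψ : symplecticGroup (Fin n) ℝ) (S : AntiInv n) : AntiInv n :=
  ⟨ψ.1 * S.1 * (ψ⁻¹).1, by
    have h1 := S.2.1
    constructor
    · calc ψ.1 * S.1 * (ψ⁻¹).1 * (ψ.1 * S.1 * (ψ⁻¹).1)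
          = ψ.1 * S.1 * ((ψ⁻¹).1 * ψ.1) * S.1 * (ψ⁻¹).1 := by simp only [Matrix.mul_assoc]
        _ = ψ.1 * (S.1 * S.1) * (ψ⁻¹).1 := by
            rw [symp_inv_mul]; simp only [Matrix.mul_assoc, Matrix.one_mul]
        _ = 1 := by rw [h1, Matrix.mul_one, symp_mul_inv]
    · intro v w
      simp only [← mulVec_mulVec]
      rw [stdOmega_symplectic, S.2.2, stdOmega_symplectic]⟩

theorem sympConj_mul (ψ φ : symplecticGroup (Fin n) ℝ) (S : AntiInv n) :
    sympConj (ψ * φ) S = sympConj ψ (sympConj φ S) := by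
  apply Subtype.ext
  simp [sympConj, _root_.mul_inv_rev, Matrix.mul_assoc]

theorem sympConj_one (S : AntiInv n) : sympConj 1 S = S := by
  apply Subtype.ext
  simp [sympConj]

theorem antiInv_fromBlocks_iff (a b c d : Matrix (Fin n) (Fin n) ℝ) :
    fromBlocks a b c d ∈ AntiInv n ↔
      bᵀ = b ∧ cᵀ = c ∧ d = -aᵀ ∧ a * a + b * c = 1 ∧ c * a = aᵀ * c ∧ a * b = b * aᵀ := by
  have hJ : ∀ S : BigMat n, S * S = 1 →
      (Sᵀ * J (Fin n) ℝ * S = -J (Fin n) ℝ ↔ Sᵀ * J (Fin n) ℝ = -(J (Fin n) ℝ * S)) := by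
    intro S hS
    constructor
    · intro h
      calc Sᵀ * J (Fin n) ℝ = Sᵀ * J (Fin n) ℝ * S * S := by
            rw [Matrix.mul_assoc _ S S, hS, Matrix.mul_one]
        _ = _ := by rw [h, Matrix.neg_mul]
    · intro h
      rw [h, Matrix.neg_mul, Matrix.mul_assoc, hS, Matrix.mul_one]
  have e1 : (fromBlocks a b c d)ᵀ * J (Fin n) ℝ = -(J (Fin n) ℝ * fromBlocks a b c d) ↔
      cᵀ = c ∧ d = -aᵀ ∧ bᵀ = b := by
    rw [Matrix.J, fromBlocks_transpose, fromBlocks_multiply, fromBlocks_multiply, fromBlocks_neg,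
      fromBlocks_inj]
    simp only [Matrix.mul_zero, Matrix.mul_one, Matrix.mul_neg, zero_add, add_zero, Matrix.neg_mul,
      Matrix.zero_mul, Matrix.one_mul, neg_neg, neg_inj]
    constructor
    · rintro ⟨h1, h2, h3, h4⟩
      exact ⟨h1, h2.symm, h4⟩
    · rintro ⟨h1, h2, h3⟩
      exact ⟨h1, h2.symm, by rw [h2]; simp, h3⟩
  have e2 : fromBlocks a b c d * fromBlocks a b c d = 1 ↔
      a * a + b * c = 1 ∧ a * b + b * d = 0 ∧ c * a + d * c = 0 ∧ c * b + d * d = 1 := by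
    rw [fromBlocks_multiply, ← fromBlocks_one, fromBlocks_inj]
  rw [antiInv_iff]
  constructor
  · rintro ⟨h1, h2⟩
    obtain ⟨h3, h4, h5⟩ := e1.mp ((hJ _ h1).mp h2)
    obtain ⟨h6, h7, h8, -⟩ := e2.mp h1
    refine ⟨h5, h3, h4, h6, ?_, ?_⟩
    · rw [h4, Matrix.neg_mul, ← sub_eq_add_neg] at h8
      exact sub_eq_zero.mp h8
    · rw [h4, Matrix.mul_neg, ← sub_eq_add_neg] at h7
      exact sub_eq_zero.mp h7
  · rintro ⟨h1, h2, h3, h4, h5, h6⟩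
    have hsq : fromBlocks a b c d * fromBlocks a b c d = 1 := by
      rw [e2]
      refine ⟨h4, ?_, ?_, ?_⟩
      · rw [h3, Matrix.mul_neg, h6, add_neg_cancel]
      · rw [h3, Matrix.neg_mul, h5, add_neg_cancel]
      · have := congrArg Matrix.transpose h4
        rw [transpose_add, transpose_mul, transpose_mul, h1, h2, transpose_one] at this
        rw [h3, Matrix.neg_mul, Matrix.mul_neg, neg_neg, add_comm, this]
    exact ⟨hsq, (hJ _ hsq).mpr (e1.mpr ⟨h2, h3, h1⟩)⟩

theorem antiInv_blocks (S : AntiInv n) :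
    S.1.toBlocks₁₂ᵀ = S.1.toBlocks₁₂ ∧ S.1.toBlocks₂₁ᵀ = S.1.toBlocks₂₁ ∧
      S.1.toBlocks₂₂ = -S.1.toBlocks₁₁ᵀ ∧
      S.1.toBlocks₁₁ * S.1.toBlocks₁₁ + S.1.toBlocks₁₂ * S.1.toBlocks₂₁ = 1 ∧
      S.1.toBlocks₂₁ * S.1.toBlocks₁₁ = S.1.toBlocks₁₁ᵀ * S.1.toBlocks₂₁ ∧
      S.1.toBlocks₁₁ * S.1.toBlocks₁₂ = S.1.toBlocks₁₂ * S.1.toBlocks₁₁ᵀ := by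
  rw [← antiInv_fromBlocks_iff, fromBlocks_toBlocks]
  exact S.2

/-- For `S = (a b; c d)` with `1 + a` invertible, the symmetric matrices `c (1 + a)⁻¹` and `b`. The
first one is the matrix whose graph is `Fix(S)`. -/
def antiCoord (S : AntiInv n) : SymMat n × SymMat n :=
  (SymMat.mk (S.1.toBlocks₂₁ * (1 + S.1.toBlocks₁₁)⁻¹) (by
    obtain ⟨-, hc, -, -, hca, -⟩ := antiInv_blocks S
    rw [transpose_mul, transpose_nonsing_inv, hc]
    by_cases hu : IsUnit (1 + S.1.toBlocks₁₁).det
    · have hut : IsUnit (1 + S.1.toBlocks₁₁)ᵀ.det := by rwa [det_transpose]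
      have h : (1 + S.1.toBlocks₁₁)ᵀ * S.1.toBlocks₂₁ =
          S.1.toBlocks₂₁ * (1 + S.1.toBlocks₁₁) := by
        rw [transpose_add, transpose_one, Matrix.add_mul, Matrix.mul_add, Matrix.one_mul,
          Matrix.mul_one, hca]
      calc ((1 + S.1.toBlocks₁₁)ᵀ)⁻¹ * S.1.toBlocks₂₁
          = ((1 + S.1.toBlocks₁₁)ᵀ)⁻¹ *
              (S.1.toBlocks₂₁ * (1 + S.1.toBlocks₁₁)) * (1 + S.1.toBlocks₁₁)⁻¹ := by
            rw [Matrix.mul_assoc, Matrix.mul_assoc, mul_nonsing_inv _ hu, Matrix.mul_one]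
        _ = _ := by
            rw [← h, ← Matrix.mul_assoc, nonsing_inv_mul _ hut, Matrix.one_mul]
    · have hut : ¬IsUnit (1 + S.1.toBlocks₁₁)ᵀ.det := by rwa [det_transpose]
      rw [nonsing_inv_apply_not_isUnit _ hu, nonsing_inv_apply_not_isUnit _ hut]
      simp),
   SymMat.mk S.1.toBlocks₁₂ (antiInv_blocks S).1)

/-- The anti-symplectic involution `(1 0; B 1) (1 D; 0 -1) (1 0; -B 1)`. Its fixed space is the
graph of `B`. -/
def antiParam (p : SymMat n × SymMat n) : AntiInv n :=
  ⟨fromBlocks (1 - p.2.toMat * p.1.toMat) p.2.toMat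
      (2 • p.1.toMat - p.1.toMat * p.2.toMat * p.1.toMat) (p.1.toMat * p.2.toMat - 1), by
    have hB := p.1.transpose_toMat
    have hD := p.2.transpose_toMat
    rw [antiInv_fromBlocks_iff]
    generalize p.1.toMat = B at *
    generalize p.2.toMat = D at *
    refine ⟨hD, ?_, ?_, ?_, ?_, ?_⟩
    all_goals
      try simp only [transpose_sub, transpose_smul, transpose_mul, transpose_one, hB, hD]
      noncomm_ring⟩

theorem antiCoord_antiParam (p : SymMat n × SymMat n)
    (hp : (2 • (1 : Matrix (Fin n) (Fin n) ℝ) - p.2.toMat * p.1.toMat).det ≠ 0) :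
    antiCoord (antiParam p) = p := by
  have h1 : (antiCoord (antiParam p)).1.toMat = p.1.toMat := by
    change (2 • p.1.toMat - p.1.toMat * p.2.toMat * p.1.toMat) *
      (1 + (1 - p.2.toMat * p.1.toMat))⁻¹ = p.1.toMat
    have e1 : 1 + (1 - p.2.toMat * p.1.toMat) =
        2 • (1 : Matrix (Fin n) (Fin n) ℝ) - p.2.toMat * p.1.toMat := by noncomm_ring
    have e2 : 2 • p.1.toMat - p.1.toMat * p.2.toMat * p.1.toMat =
        p.1.toMat * (2 • (1 : Matrix (Fin n) (Fin n) ℝ) - p.2.toMat * p.1.toMat) := by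
      noncomm_ring
    rw [e1, e2, Matrix.mul_assoc, mul_nonsing_inv _ (isUnit_iff_ne_zero.mpr hp), Matrix.mul_one]
  exact Prod.ext (SymMat.ext h1) (SymMat.ext rfl)

theorem antiParam_antiCoord (S : AntiInv n) (hS : (1 + S.1.toBlocks₁₁).det ≠ 0) :
    (antiCoord S).2.toMat * (antiCoord S).1.toMat = 1 - S.1.toBlocks₁₁ ∧
      antiParam (antiCoord S) = S := by
  have hu : IsUnit (1 + S.1.toBlocks₁₁).det := isUnit_iff_ne_zero.mpr hS
  obtain ⟨hb, hc, hd, h4, -, -⟩ := antiInv_blocks S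
  have hD : (antiCoord S).2.toMat = S.1.toBlocks₁₂ := rfl
  have hB' : (antiCoord S).1.toMat = S.1.toBlocks₂₁ * (1 + S.1.toBlocks₁₁)⁻¹ := rfl
  have hB : (antiCoord S).1.toMat * (1 + S.1.toBlocks₁₁) = S.1.toBlocks₂₁ := by
    rw [hB', Matrix.mul_assoc, nonsing_inv_mul _ hu, Matrix.mul_one]
  have hBt := (antiCoord S).1.transpose_toMat
  have key : (antiCoord S).2.toMat * (antiCoord S).1.toMat = 1 - S.1.toBlocks₁₁ := by
    have e : S.1.toBlocks₁₂ * S.1.toBlocks₂₁ =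
        (1 - S.1.toBlocks₁₁) * (1 + S.1.toBlocks₁₁) := by
      rw [← h4]
      have : S.1.toBlocks₁₂ * S.1.toBlocks₂₁ = 1 - S.1.toBlocks₁₁ * S.1.toBlocks₁₁ := by
        rw [← h4]; noncomm_ring
      rw [this]; noncomm_ring
    rw [hD, hB', ← Matrix.mul_assoc, e, Matrix.mul_assoc, mul_nonsing_inv _ hu, Matrix.mul_one]
  refine ⟨key, Subtype.ext ?_⟩
  rw [← fromBlocks_toBlocks S.1]
  change fromBlocks (1 - (antiCoord S).2.toMat * (antiCoord S).1.toMat) (antiCoord S).2.toMat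
      (2 • (antiCoord S).1.toMat -
        (antiCoord S).1.toMat * (antiCoord S).2.toMat * (antiCoord S).1.toMat)
      ((antiCoord S).1.toMat * (antiCoord S).2.toMat - 1) = _
  rw [Matrix.mul_assoc, fromBlocks_inj]
  refine ⟨?_, hD, ?_, ?_⟩
  · rw [key]; noncomm_ring
  · rw [key, ← hB]; noncomm_ring
  · have h5 := congrArg Matrix.transpose key
    rw [transpose_mul, hBt, hD, hb, transpose_sub, transpose_one] at h5
    rw [hD, h5, hd]; noncomm_ring

theorem contDiff_antiParam :
    ContDiff ℝ ∞ (fun p : SymMat n × SymMat n => (antiParam p).1) := by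
  rw [← contDiffOn_univ]
  have hB : ContDiffOn ℝ ∞ (fun p : SymMat n × SymMat n => p.1.toMat) univ :=
    (SymMat.contDiff_toMat.comp contDiff_fst).contDiffOn
  have hD : ContDiffOn ℝ ∞ (fun p : SymMat n × SymMat n => p.2.toMat) univ :=
    (SymMat.contDiff_toMat.comp contDiff_snd).contDiffOn
  have h1 := contDiffOn_const (c := (1 : Matrix (Fin n) (Fin n) ℝ)) |>.sub
    (contDiffOn_matrix_mul hD hB)
  have h2 := (hB.const_smul (2 : ℕ)).sub (contDiffOn_matrix_mul (contDiffOn_matrix_mul hB hD) hB)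
  have h3 := (contDiffOn_matrix_mul hB hD).sub
    (contDiffOn_const (c := (1 : Matrix (Fin n) (Fin n) ℝ)))
  rw [contDiffOn_matrix] at h1 h2 h3 hD ⊢
  rintro (i | i) (j | j)
  · exact h1 i j
  · exact hD i j
  · exact h2 i j
  · exact h3 i j

theorem contDiffOn_antiCoord {E : Type*} [NormedAddCommGroup E] [NormedSpace ℝ E] {s : Set E}
    {f : E → AntiInv n} (hf : ContDiffOn ℝ ∞ (fun x => (f x).1) s)
    (h : ∀ x ∈ s, (1 + (f x).1.toBlocks₁₁).det ≠ 0) :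
    ContDiffOn ℝ ∞ (fun x => antiCoord (f x)) s := by
  rw [contDiffOn_matrix] at hf
  have ha : ContDiffOn ℝ ∞ (fun x => (f x).1.toBlocks₁₁) s :=
    contDiffOn_matrix.mpr fun _ _ => hf _ _
  have hb : ContDiffOn ℝ ∞ (fun x => (f x).1.toBlocks₁₂) s :=
    contDiffOn_matrix.mpr fun _ _ => hf _ _
  have hc : ContDiffOn ℝ ∞ (fun x => (f x).1.toBlocks₂₁) s :=
    contDiffOn_matrix.mpr fun _ _ => hf _ _
  refine ContDiffOn.prodMk (f := fun x => (antiCoord (f x)).1) (g := fun x => (antiCoord (f x)).2)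
    ?_ ?_
  · rw [contDiffOn_symMat]
    exact contDiffOn_matrix_mul hc (contDiffOn_matrix_inv (contDiffOn_const.add ha) h)
  · rw [contDiffOn_symMat]
    exact hb

theorem continuous_sympConj (ψ : symplecticGroup (Fin n) ℝ) : Continuous (sympConj ψ) :=
  Continuous.subtype_mk
    ((continuous_const.matrix_mul continuous_subtype_val).matrix_mul continuous_const) _

theorem continuous_blocks₁₁ : Continuous fun S : AntiInv n => S.1.toBlocks₁₁ :=
  continuous_matrix fun _ _ => continuous_subtype_val.matrix_elem _ _

theorem continuousOn_symMat {X : Type*} [TopologicalSpace X] {s : Set X} {f : X → SymMat n} :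
    ContinuousOn f s ↔ ContinuousOn (fun x => (f x).toMat) s := by
  constructor
  · intro h
    exact SymMat.contDiff_toMat.continuous.comp_continuousOn h
  · intro h
    obtain ⟨p, hp⟩ := LinearMap.exists_leftInverse_of_injective (SymMat.toMat (n := n))
      (Submodule.ker_subtype _)
    refine ((LinearMap.toContinuousLinearMap p).continuous.comp_continuousOn h).congr fun x _ => ?_
    exact (LinearMap.congr_fun hp (f x)).symm

theorem continuousOn_antiCoord :
    ContinuousOn (antiCoord (n := n)) {S | (1 + S.1.toBlocks₁₁).det ≠ 0} := by
  have hb : Continuous fun S : AntiInv n => S.1.toBlocks₁₂ :=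
    continuous_matrix fun _ _ => continuous_subtype_val.matrix_elem _ _
  have hc : Continuous fun S : AntiInv n => S.1.toBlocks₂₁ :=
    continuous_matrix fun _ _ => continuous_subtype_val.matrix_elem _ _
  have hinv : ContinuousOn (fun A : Matrix (Fin n) (Fin n) ℝ => A⁻¹) {A | A.det ≠ 0} :=
    (contDiffOn_matrix_inv contDiffOn_id fun _ h => h).continuousOn
  refine ContinuousOn.prodMk (f := fun S => (antiCoord S).1) (g := fun S => (antiCoord S).2) ?_ ?_
  · rw [continuousOn_symMat]
    refine ContinuousOn.mul (M := Matrix (Fin n) (Fin n) ℝ) hc.continuousOn ?_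
    exact hinv.comp (continuous_const.add continuous_blocks₁₁).continuousOn fun _ h => h
  · rw [continuousOn_symMat]
    exact hb.continuousOn

/-- The chart `S ↦ antiCoord (ψ⁻¹ S ψ)` of the space of anti-symplectic involutions. It is the
restriction of a smooth map on an open set of matrices, and its inverse is smooth as a map
into the space of matrices. -/
def antiChart (ψ : symplecticGroup (Fin n) ℝ) :
    OpenPartialHomeomorph (AntiInv n) (SymMat n × SymMat n) where
  toFun S := antiCoord (sympConj ψ⁻¹ S)
  invFun p := sympConj ψ (antiParam p)
  source := {S | (1 + (sympConj ψ⁻¹ S).1.toBlocks₁₁).det ≠ 0}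
  target := {p | (2 • (1 : Matrix (Fin n) (Fin n) ℝ) - p.2.toMat * p.1.toMat).det ≠ 0}
  map_source' S hS := by
    rw [mem_ofPred_eq, (antiParam_antiCoord _ hS).1]
    rw [mem_ofPred_eq] at hS
    convert hS using 2
    noncomm_ring
  map_target' p hp := by
    rw [mem_ofPred_eq, ← sympConj_mul, inv_mul_cancel, sympConj_one]
    rw [mem_ofPred_eq] at hp
    convert hp using 2
    change 1 + (1 - p.2.toMat * p.1.toMat) = _
    noncomm_ring
  left_inv' S hS := by
    rw [(antiParam_antiCoord _ hS).2, ← sympConj_mul, mul_inv_cancel, sympConj_one]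
  right_inv' p hp := by
    rw [← sympConj_mul, inv_mul_cancel, sympConj_one, antiCoord_antiParam p hp]
  open_source := by
    refine isOpen_ne_fun (Continuous.matrix_det ?_) continuous_const
    exact continuous_const.add (continuous_blocks₁₁.comp (continuous_sympConj _))
  open_target := by
    refine isOpen_ne_fun (Continuous.matrix_det ?_) continuous_const
    exact continuous_const.sub
      ((SymMat.contDiff_toMat.continuous.comp continuous_snd).matrix_mul
        (SymMat.contDiff_toMat.continuous.comp continuous_fst))
  continuousOn_toFun :=
    continuousOn_antiCoord.comp (continuous_sympConj _).continuousOn fun _ h => h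
  continuousOn_invFun :=
    ((continuous_sympConj ψ).comp
      (Continuous.subtype_mk contDiff_antiParam.continuous _)).continuousOn

theorem exists_antiChart (S : AntiInv n) :
    ∃ ψ : symplecticGroup (Fin n) ℝ, S ∈ (antiChart ψ).source := by
  obtain ⟨ψ, hψ⟩ := exists_symp_of_lagrangian (fixSpace S)
  refine ⟨ψ, ?_⟩
  have h1 : (sympConj ψ⁻¹ S).1.toBlocks₁₁ = 1 := by
    refine ext_of_mulVec_single fun i => ?_
    have h2 : ψ.1 *ᵥ Sum.elim (Pi.single i 1) 0 ∈ (fixSpace S).carrier := by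
      rw [← hψ]
      refine ⟨_, ?_, rfl⟩
      change _ ∈ (stdGraph 0).carrier
      rw [mem_stdGraph]
      simp
      rfl
    have h3 : S.1 *ᵥ (ψ.1 *ᵥ Sum.elim (Pi.single i 1) 0) =
        ψ.1 *ᵥ Sum.elim (Pi.single i 1) 0 := h2
    have h4 : (sympConj ψ⁻¹ S).1 *ᵥ Sum.elim (Pi.single i 1) 0 = Sum.elim (Pi.single i 1) 0 := by
      simp only [sympConj, inv_inv, ← mulVec_mulVec]
      rw [h3, mulVec_mulVec, symp_inv_mul, one_mulVec]
    rw [← fromBlocks_toBlocks (sympConj ψ⁻¹ S).1, fromBlocks_mulVec] at h4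
    rw [one_mulVec]
    ext k
    have h5 := congrFun h4 (Sum.inl k)
    have e1 : (Sum.elim (Pi.single i 1) 0 : StdSpace n) ∘ Sum.inl = Pi.single i 1 := rfl
    have e2 : (Sum.elim (Pi.single i 1) 0 : StdSpace n) ∘ Sum.inr = 0 := rfl
    rw [e1, e2, mulVec_zero, add_zero, Sum.elim_inl, Sum.elim_inl] at h5
    exact h5
  change (1 + (sympConj ψ⁻¹ S).1.toBlocks₁₁).det ≠ 0
  rw [h1, ← two_smul ℝ (1 : Matrix (Fin n) (Fin n) ℝ), det_smul, det_one]
  positivity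

/-- The smooth structure on the space of anti-symplectic involutions (with its subspace topology). -/
instance instChartedSpaceAntiInv (n : ℕ) : ChartedSpace (SymMat n × SymMat n) (AntiInv n) where
  atlas := Set.range antiChart
  chartAt S := antiChart (exists_antiChart S).choose
  mem_chart_source S := (exists_antiChart S).choose_spec
  chart_mem_atlas _ := mem_range_self _

instance instIsManifoldAntiInv (n : ℕ) :
    IsManifold 𝓘(ℝ, SymMat n × SymMat n) ∞ (AntiInv n) := by
  apply isManifold_of_contDiffOn
  rintro _ _ ⟨ψ, rfl⟩ ⟨φ, rfl⟩
  simp only [modelWithCornersSelf_coe, modelWithCornersSelf_coe_symm, range_id, inter_univ,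
    preimage_id, Function.comp_id, Function.id_comp]
  refine contDiffOn_antiCoord (f := fun p => sympConj φ⁻¹ (sympConj ψ (antiParam p))) ?_ ?_
  · exact contDiffOn_matrix_mul (contDiffOn_matrix_mul contDiffOn_const
      (contDiffOn_matrix_mul (contDiffOn_matrix_mul contDiffOn_const
        contDiff_antiParam.contDiffOn) contDiffOn_const)) contDiffOn_const
  · exact fun p hp => hp.2

end AntiSymplecticInvolutions

end

/-! An involution is the same thing as a splitting of the space into its eigenspaces for 1 and -1,
and it is anti-symplectic exactly when both eigenspaces are Lagrangian. This gives the first claim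
(`isCompl_fixSpace`, `antiInv_eq_of_fixSpace`, `exists_antiInv_of_isCompl`).

For the diffeomorphism, a tangent vector of the Lagrangian Grassmannian at `L` is treated as a
symmetric bilinear form on `L`. If `X` is its coordinate in the graph chart of `ψ` at `ψ(graph C)`,
then `X` is the matrix of that form in the basis of `L` given by the columns of `lagFrame ψ C`. That
this does not depend on the chart is `symCongr_fderiv_transition`: a transition map acts on
velocities by congruence with the base change matrix of the two frames.

To `S` one attaches the form `-ω(S J v, J w) / 2` on `L = Fix(S)`, whose matrix in a frame is
`tanForm`. It obeys the same base change law (`tanForm_mul`), so its coordinate in every chart is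
given by one and the same formula (`tanCoord_tanVec`), and smoothness can be checked in a single
chart around each point. The involutions fixing exactly `L = ψ(graph C)` form an affine family in a
symmetric matrix `D`, on which the form is `const - N D N / 2` with `N` the invertible Gram matrix
of the frame (`tanForm_sympConj_antiParam`). Solving for `D` gives the inverse, smooth in `C` and in
the form.

For an orthonormal basis of `L` the frame extends to a unitary map, the Gram matrix is the identity,
and the form of the involution whose second eigenspace is the graph of `B` over `J L` has matrix `B`
itself. Hence the composite in the last claim is linear, being just a change of basis for forms. -/

noncomputable section

/-! ### Involutions and complementary pairs of Lagrangian subspaces. -/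

section Complementary

variable {n : ℕ}

theorem stdOmega_neg_left (v w : StdSpace n) : stdOmega (-v) w = -stdOmega v w := by
  simp [stdOmega_eq]

theorem stdOmega_neg_right (v w : StdSpace n) : stdOmega v (-w) = -stdOmega v w := by
  simp [stdOmega_eq, mulVec_neg]

theorem mem_fixSpace {S : AntiInv n} {v : StdSpace n} :
    v ∈ (fixSpace S).carrier ↔ S.1 *ᵥ v = v := Iff.rfl

theorem mem_fixSpace_neg {S : AntiInv n} {v : StdSpace n} :
    v ∈ (fixSpace (-S)).carrier ↔ S.1 *ᵥ v = -v := by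
  rw [mem_fixSpace]
  change (-S.1) *ᵥ v = v ↔ _
  rw [neg_mulVec, neg_eq_iff_eq_neg]

/-- Every vector splits as `v = (v + S v) / 2 + (v - S v) / 2`. -/
theorem isCompl_fixSpace (S : AntiInv n) :
    IsCompl (fixSpace S).carrier (fixSpace (-S)).carrier := by
  have hS : ∀ v, S.1 *ᵥ (S.1 *ᵥ v) = v := fun v => by
    rw [mulVec_mulVec, S.2.1, one_mulVec]
  constructor
  · rw [Submodule.disjoint_def]
    intro v h1 h2
    rw [mem_fixSpace] at h1
    rw [mem_fixSpace_neg, h1] at h2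
    exact self_eq_neg.mp h2
  · rw [codisjoint_iff, eq_top_iff]
    intro v _
    refine Submodule.mem_sup.mpr ⟨(1 / 2 : ℝ) • (v + S.1 *ᵥ v), ?_, (1 / 2 : ℝ) • (v - S.1 *ᵥ v),
      ?_, by module⟩
    · rw [mem_fixSpace, mulVec_smul, mulVec_add, hS, add_comm]
    · rw [mem_fixSpace_neg, mulVec_smul, mulVec_sub, hS, ← smul_neg, neg_sub]

/-- The two eigenspaces span, and on each of them the involution is prescribed. -/
theorem antiInv_eq_of_fixSpace {S T : AntiInv n} (h : fixSpace S = fixSpace T)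
    (h' : fixSpace (-S) = fixSpace (-T)) : S = T := by
  apply Subtype.ext
  refine ext_of_mulVec_single fun i => ?_
  obtain ⟨a, ha, b, hb, hab⟩ := Submodule.mem_sup.mp
    ((isCompl_fixSpace S).sup_eq_top.ge (Submodule.mem_top (x := Pi.single i 1)))
  have ha' := ha
  have hb' := hb
  rw [h, mem_fixSpace] at ha'
  rw [h', mem_fixSpace_neg] at hb'
  rw [mem_fixSpace] at ha
  rw [mem_fixSpace_neg] at hb
  rw [← hab, mulVec_add, mulVec_add, ha, hb, ha', hb']

/-- The involution is the projection onto `L` along `M` minus the projection onto `M` along `L`. It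
reverses `ω` because only the mixed terms `ω(a, b')` and `ω(b, a')` survive on Lagrangian summands,
and both change sign. -/
theorem exists_antiInv_of_isCompl {L M : LagGr n} (h : IsCompl L.carrier M.carrier) :
    ∃ S : AntiInv n, fixSpace S = L ∧ fixSpace (-S) = M := by
  let f : StdSpace n →ₗ[ℝ] StdSpace n :=
    L.carrier.subtype ∘ₗ L.carrier.projectionOnto M.carrier h -
      M.carrier.subtype ∘ₗ M.carrier.projectionOnto L.carrier h.symm
  have hf : ∀ a ∈ L.carrier, ∀ b ∈ M.carrier, f (a + b) = a - b := by
    intro a ha b hb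
    have e1 := Submodule.projectionOnto_apply_left h ⟨a, ha⟩
    have e2 := Submodule.projectionOnto_apply_of_mem_right h hb
    have e3 := Submodule.projectionOnto_apply_left h.symm ⟨b, hb⟩
    have e4 := Submodule.projectionOnto_apply_of_mem_right h.symm ha
    simp only at e1 e3
    simp [f, e1, e2, e3, e4]
  have hd : ∀ v, ∃ a ∈ L.carrier, ∃ b ∈ M.carrier, a + b = v := fun v =>
    Submodule.mem_sup.mp (h.sup_eq_top.ge (Submodule.mem_top (x := v)))
  have hm : ∀ v, LinearMap.toMatrix' f *ᵥ v = f v := fun v => by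
    rw [← Matrix.toLin'_apply, Matrix.toLin'_toMatrix']
  have hL : ∀ a ∈ L.carrier, f a = a := fun a ha => by
    simpa using hf a ha 0 M.carrier.zero_mem
  have hM : ∀ b ∈ M.carrier, f b = -b := fun b hb => by
    simpa using hf 0 L.carrier.zero_mem b hb
  let S : AntiInv n := ⟨LinearMap.toMatrix' f, by
    constructor
    · refine ext_of_mulVec_single fun i => ?_
      obtain ⟨a, ha, b, hb, hab⟩ := hd (Pi.single i 1)
      rw [← hab, one_mulVec, ← mulVec_mulVec, hm, hm, hf a ha b hb, map_sub, hL a ha, hM b hb,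
        sub_neg_eq_add]
    · intro v w
      obtain ⟨a, ha, b, hb, rfl⟩ := hd v
      obtain ⟨a', ha', b', hb', rfl⟩ := hd w
      rw [hm, hm, hf a ha b hb, hf a' ha' b' hb', sub_eq_add_neg, sub_eq_add_neg]
      simp only [stdOmega_add_left, stdOmega_add_right, stdOmega_neg_left, stdOmega_neg_right]
      rw [(L.isLagrangian a).mp ha a' ha', (M.isLagrangian b).mp hb b' hb']
      ring⟩
  -- Nested Lagrangian subspaces are equal, so one inclusion suffices for each eigenspace.
  refine ⟨S, (LagGr.ext (IsLagrangian.eq_of_le L.isLagrangian (fixSpace S).isLagrangian ?_)).symm,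
    (LagGr.ext (IsLagrangian.eq_of_le M.isLagrangian (fixSpace (-S)).isLagrangian ?_)).symm⟩
  · intro a ha
    rw [mem_fixSpace]
    exact (hm a).trans (hL a ha)
  · intro b hb
    rw [mem_fixSpace_neg]
    exact (hm b).trans (hM b hb)

end Complementary

/-! ### Frames, base change, and the bilinear form attached to an involution. -/

section TangentForm

variable {n : ℕ}

/-- The matrix with columns `(eᵢ, C eᵢ)`, which is a basis of the graph of `C`. -/
def graphMat (C : SymMat n) : Matrix (Fin n ⊕ Fin n) (Fin n) ℝ := fromRows 1 C.toMat

/-- The columns of this matrix form a basis of the Lagrangian subspace `ψ(graph C)`. -/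
def lagFrame (ψ : symplecticGroup (Fin n) ℝ) (C : SymMat n) :
    Matrix (Fin n ⊕ Fin n) (Fin n) ℝ := ψ.1 * graphMat C

theorem graphMat_mulVec (C : SymMat n) (x : Fin n → ℝ) :
    graphMat C *ᵥ x = Sum.elim x (C.toMat *ᵥ x) := by
  rw [graphMat, fromRows_mulVec, one_mulVec]

theorem mem_stdGraph_iff_exists (C : SymMat n) (v : StdSpace n) :
    v ∈ (stdGraph C).carrier ↔ ∃ x, graphMat C *ᵥ x = v := by
  simp only [mem_stdGraph, graphMat_mulVec]
  constructor
  · intro h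
    refine ⟨fun i => v (Sum.inl i), ?_⟩
    rw [← h]
    ext (i | i) <;> rfl
  · rintro ⟨x, rfl⟩
    rfl

theorem mem_lagParam_iff_exists (ψ : symplecticGroup (Fin n) ℝ) (C : SymMat n) (v : StdSpace n) :
    v ∈ (lagParam ψ C).carrier ↔ ∃ x, lagFrame ψ C *ᵥ x = v := by
  change v ∈ (stdGraph C).carrier.map ψ.1.mulVecLin ↔ _
  simp only [Submodule.mem_map, mem_stdGraph_iff_exists, mulVecLin_apply, lagFrame]
  constructor
  · rintro ⟨_, ⟨x, rfl⟩, rfl⟩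
    exact ⟨x, by rw [mulVec_mulVec]⟩
  · rintro ⟨x, rfl⟩
    exact ⟨_, ⟨x, rfl⟩, by rw [mulVec_mulVec]⟩

/-- The columns are independent: `ψ` is invertible and the upper block of `graphMat C` is the
identity. -/
theorem lagFrame_mulVec_eq_zero {ψ : symplecticGroup (Fin n) ℝ} {C : SymMat n} {x : Fin n → ℝ}
    (h : lagFrame ψ C *ᵥ x = 0) : x = 0 := by
  have h1 : graphMat C *ᵥ x = 0 := by
    rw [← one_mulVec (graphMat C *ᵥ x), ← symp_inv_mul ψ, ← mulVec_mulVec,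
      mulVec_mulVec _ ψ.1, ← lagFrame, h, mulVec_zero]
  rw [graphMat_mulVec] at h1
  ext i
  exact congrFun h1 (Sum.inl i)

/-- The Gram matrix of a frame. -/
def gramMat (F : Matrix (Fin n ⊕ Fin n) (Fin n) ℝ) : Matrix (Fin n) (Fin n) ℝ := Fᵀ * F

theorem transpose_gramMat (F : Matrix (Fin n ⊕ Fin n) (Fin n) ℝ) : (gramMat F)ᵀ = gramMat F := by
  simp [gramMat]

/-- A kernel vector `x` of the Gram matrix of `F` satisfies `|F x|² = 0`. -/
theorem det_gramMat_lagFrame_ne_zero (ψ : symplecticGroup (Fin n) ℝ) (C : SymMat n) :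
    (gramMat (lagFrame ψ C)).det ≠ 0 := by
  intro h
  obtain ⟨x, hx, hx'⟩ := exists_mulVec_eq_zero_iff.mpr h
  refine hx (lagFrame_mulVec_eq_zero (ψ := ψ) (C := C) (dotProduct_self_eq_zero.mp ?_))
  rw [dotProduct_mulVec, ← mulVec_transpose, mulVec_mulVec, dotProduct_comm, ← gramMat, hx',
    dotProduct_zero]

/-- The base change matrix between two frames of the same Lagrangian subspace. -/
def frameChange (θ : symplecticGroup (Fin n) ℝ) (C : SymMat n) : Matrix (Fin n) (Fin n) ℝ :=
  θ.1.toBlocks₁₁ + θ.1.toBlocks₁₂ * C.toMat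

/-- The map `φ⁻¹ ψ` carries the graph of `B` onto the graph of `C`, so it sends the columns of
`graphMat B` to vectors of the latter graph, which are determined by their upper halves. Those upper
halves are the columns of `frameChange`. -/
theorem lagFrame_eq_mul_frameChange {ψ φ : symplecticGroup (Fin n) ℝ} {B C : SymMat n}
    (h : lagParam ψ B = lagParam φ C) :
    lagFrame ψ B = lagFrame φ C * frameChange (φ⁻¹ * ψ) B := by
  have h1 := (sympImage_stdGraph_eq _ _ _).mp ((lagParam_eq_iff _ _ _ _).mp h)
  have h2 : (φ⁻¹ * ψ).1 * graphMat B = graphMat C * frameChange (φ⁻¹ * ψ) B := by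
    conv_lhs => rw [← fromBlocks_toBlocks (φ⁻¹ * ψ).1]
    rw [graphMat, graphMat, fromBlocks_mul_fromRows, fromRows_mul, Matrix.mul_one, Matrix.mul_one,
      h1, Matrix.one_mul, frameChange]
  rw [lagFrame, lagFrame, Matrix.mul_assoc, ← h2, ← Matrix.mul_assoc]
  congr 1
  change ψ.1 = (φ * (φ⁻¹ * ψ)).1
  rw [mul_inv_cancel_left]

theorem det_frameChange_ne_zero {ψ φ : symplecticGroup (Fin n) ℝ} {B C : SymMat n}
    (h : lagParam ψ B = lagParam φ C) : (frameChange (φ⁻¹ * ψ) B).det ≠ 0 := by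
  intro h0
  obtain ⟨x, hx, hx'⟩ := exists_mulVec_eq_zero_iff.mpr h0
  refine hx (lagFrame_mulVec_eq_zero (ψ := ψ) (C := B) ?_)
  rw [lagFrame_eq_mul_frameChange h, ← mulVec_mulVec, hx', mulVec_zero]

/-- This makes `S J` symmetric, hence also the form `tanForm`. From `Sᵀ J S = -J` and `S² = 1` one
gets `Sᵀ J = -J S`; multiplying by `J` on both sides gives the claim. -/
theorem antiInv_J_mul_transpose (S : AntiInv n) :
    J (Fin n) ℝ * S.1ᵀ = -(S.1 * J (Fin n) ℝ) := by
  obtain ⟨h1, h2⟩ := (antiInv_iff S.1).mp S.2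
  have h3 : S.1ᵀ * J (Fin n) ℝ = -(J (Fin n) ℝ * S.1) := by
    calc S.1ᵀ * J (Fin n) ℝ = S.1ᵀ * J (Fin n) ℝ * S.1 * S.1 := by
          rw [Matrix.mul_assoc _ S.1 S.1, h1, Matrix.mul_one]
      _ = _ := by rw [h2, Matrix.neg_mul]
  have h4 : J (Fin n) ℝ * (S.1ᵀ * J (Fin n) ℝ) * J (Fin n) ℝ =
      J (Fin n) ℝ * -(J (Fin n) ℝ * S.1) * J (Fin n) ℝ := by rw [h3]
  have e1 : J (Fin n) ℝ * (S.1ᵀ * J (Fin n) ℝ) * J (Fin n) ℝ = -(J (Fin n) ℝ * S.1ᵀ) := by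
    rw [Matrix.mul_assoc, Matrix.mul_assoc, J_squared]; simp
  have e2 : J (Fin n) ℝ * -(J (Fin n) ℝ * S.1) * J (Fin n) ℝ = S.1 * J (Fin n) ℝ := by
    rw [Matrix.mul_neg, ← Matrix.mul_assoc, J_squared]; simp
  rw [e1, e2] at h4
  rw [← h4, neg_neg]

/-- The symmetric matrix of the bilinear form `(v, w) ↦ -ω(S J v, J w) / 2` with respect to the
columns of `F`. -/
def tanForm (S : AntiInv n) (F : Matrix (Fin n ⊕ Fin n) (Fin n) ℝ) : SymMat n :=
  SymMat.mk (-(1 / 2 : ℝ) • (Fᵀ * (S.1 * J (Fin n) ℝ) * F)) (by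
    have h : (S.1 * J (Fin n) ℝ)ᵀ = S.1 * J (Fin n) ℝ := by
      rw [transpose_mul, J_transpose, Matrix.neg_mul, antiInv_J_mul_transpose, neg_neg]
    rw [transpose_smul, transpose_mul, transpose_mul, h, transpose_transpose, ← Matrix.mul_assoc])

/-- The action `X ↦ pᵀ X p` on symmetric matrices. -/
def symCongr (p : Matrix (Fin n) (Fin n) ℝ) (X : SymMat n) : SymMat n :=
  SymMat.mk (pᵀ * X.toMat * p) (by
    simp only [transpose_mul, transpose_transpose, X.transpose_toMat, Matrix.mul_assoc])

theorem toMat_symCongr (p : Matrix (Fin n) (Fin n) ℝ) (X : SymMat n) :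
    (symCongr p X).toMat = pᵀ * X.toMat * p := rfl

theorem toMat_tanForm (S : AntiInv n) (F : Matrix (Fin n ⊕ Fin n) (Fin n) ℝ) :
    (tanForm S F).toMat = -(1 / 2 : ℝ) • (Fᵀ * (S.1 * J (Fin n) ℝ) * F) := rfl

/-- This base change law for bilinear forms is the one that `symCongr_fderiv_transition` proves for
tangent vectors. -/
theorem tanForm_mul (S : AntiInv n) (F : Matrix (Fin n ⊕ Fin n) (Fin n) ℝ)
    (p : Matrix (Fin n) (Fin n) ℝ) : tanForm S (F * p) = symCongr p (tanForm S F) := by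
  apply SymMat.ext
  simp only [toMat_symCongr, toMat_tanForm, transpose_mul, Matrix.mul_smul, Matrix.smul_mul,
    Matrix.mul_assoc]

theorem symCongr_mul (p q : Matrix (Fin n) (Fin n) ℝ) (X : SymMat n) :
    symCongr p (symCongr q X) = symCongr (q * p) X := by
  apply SymMat.ext
  simp only [toMat_symCongr, transpose_mul, Matrix.mul_assoc]

theorem symCongr_one (X : SymMat n) : symCongr 1 X = X := by
  apply SymMat.ext
  simp [toMat_symCongr]

theorem symCongr_injective {p : Matrix (Fin n) (Fin n) ℝ} (hp : p.det ≠ 0) :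
    Function.Injective (symCongr p) := by
  intro X Y h
  rw [← symCongr_one X, ← symCongr_one Y, ← mul_nonsing_inv p (isUnit_iff_ne_zero.mpr hp),
    ← symCongr_mul, ← symCongr_mul, h]

/-- The linear automorphism `X ↦ pᵀ X p` of the space of symmetric matrices. -/
def symCongrEquiv (p : Matrix (Fin n) (Fin n) ℝ) (hp : p.det ≠ 0) : SymMat n ≃ₗ[ℝ] SymMat n where
  toFun := symCongr p
  invFun := symCongr p⁻¹
  map_add' X Y := by
    apply SymMat.ext
    simp [toMat_symCongr, Matrix.mul_add, Matrix.add_mul]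
  map_smul' a X := by
    apply SymMat.ext
    simp [toMat_symCongr]
  left_inv X := by
    rw [symCongr_mul, mul_nonsing_inv p (isUnit_iff_ne_zero.mpr hp), symCongr_one]
  right_inv X := by
    rw [symCongr_mul, nonsing_inv_mul p (isUnit_iff_ne_zero.mpr hp), symCongr_one]

theorem J_mul_symp_inv (ψ : symplecticGroup (Fin n) ℝ) :
    J (Fin n) ℝ * (ψ⁻¹).1 = ψ.1ᵀ * J (Fin n) ℝ := by
  conv_lhs => rw [← SymplecticGroup.mem_iff'.mp ψ.2]
  rw [Matrix.mul_assoc, symp_mul_inv, Matrix.mul_one]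

/-- The involution is affine in `D`: two involutions with the same fixed space `L` differ by a map
that vanishes on `L` and takes values in `L`, here written through a frame of `L`. -/
theorem sympConj_antiParam (ψ : symplecticGroup (Fin n) ℝ) (C D : SymMat n) :
    (sympConj ψ (antiParam (C, D))).1 = (sympConj ψ (antiParam (C, 0))).1 -
      lagFrame ψ C * D.toMat * (lagFrame ψ C)ᵀ * J (Fin n) ℝ := by
  have h1 : (antiParam (C, D)).1 = (antiParam (C, 0)).1 -
      graphMat C * D.toMat * (graphMat C)ᵀ * J (Fin n) ℝ := by
    have e : (graphMat C)ᵀ * J (Fin n) ℝ = fromCols C.toMat (-1) := by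
      rw [graphMat, transpose_fromRows, Matrix.J, fromCols_mul_fromBlocks, C.transpose_toMat]
      simp
    rw [Matrix.mul_assoc, e, graphMat, fromRows_mul, fromRows_mul_fromCols]
    simp only [antiParam, map_zero, Matrix.mul_zero, Matrix.zero_mul]
    rw [eq_sub_iff_add_eq, fromBlocks_add]
    congr 1 <;> noncomm_ring
  simp only [sympConj, h1, lagFrame, transpose_mul, Matrix.mul_sub, Matrix.sub_mul]
  congr 1
  simp only [Matrix.mul_assoc]
  rw [J_mul_symp_inv]

/-- With `F` the frame, `J² = -1` turns the linear part `F D Fᵀ J` into `-N D N`, where `N = Fᵀ F`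
is invertible. So on each fibre the form is an affine bijective function of `D`. -/
theorem tanForm_sympConj_antiParam (ψ : symplecticGroup (Fin n) ℝ) (C D : SymMat n) :
    tanForm (sympConj ψ (antiParam (C, D))) (lagFrame ψ C) =
      tanForm (sympConj ψ (antiParam (C, 0))) (lagFrame ψ C) -
        (1 / 2 : ℝ) • symCongr (gramMat (lagFrame ψ C)) D := by
  apply SymMat.ext
  rw [map_sub, map_smul, toMat_symCongr, toMat_tanForm, toMat_tanForm, sympConj_antiParam,
    transpose_gramMat]
  set F := lagFrame ψ C
  have h : Fᵀ * (F * D.toMat * Fᵀ * J (Fin n) ℝ * J (Fin n) ℝ) * F =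
      -(gramMat F * D.toMat * gramMat F) := by
    rw [Matrix.mul_assoc _ (J (Fin n) ℝ), J_squared]
    simp only [gramMat, Matrix.mul_neg, Matrix.mul_one, Matrix.neg_mul, Matrix.mul_assoc]
  rw [Matrix.sub_mul, Matrix.mul_sub, Matrix.sub_mul, h]
  module

theorem fixSpace_antiParam (C D : SymMat n) : fixSpace (antiParam (C, D)) = stdGraph C := by
  symm
  refine LagGr.ext (IsLagrangian.eq_of_le (stdGraph C).isLagrangian
    (fixSpace _).isLagrangian fun v hv => ?_)
  obtain ⟨x, rfl⟩ := (mem_stdGraph_iff_exists C v).mp hv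
  rw [mem_fixSpace, graphMat_mulVec]
  simp only [antiParam, fromBlocks_mulVec, Sum.elim_comp_inl, Sum.elim_comp_inr, mulVec_mulVec,
    ← add_mulVec]
  congr 2
  · rw [sub_add_cancel, one_mulVec]
  · noncomm_ring

theorem fixSpace_sympConj (ψ : symplecticGroup (Fin n) ℝ) (S : AntiInv n) :
    fixSpace (sympConj ψ S) = sympImage ψ (fixSpace S) := by
  symm
  refine LagGr.ext (IsLagrangian.eq_of_le (sympImage ψ (fixSpace S)).isLagrangian
    (fixSpace _).isLagrangian ?_)
  rintro _ ⟨v, hv, rfl⟩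
  rw [SetLike.mem_coe, mem_fixSpace] at hv
  rw [mem_fixSpace, mulVecLin_apply]
  simp only [sympConj]
  rw [mulVec_mulVec, Matrix.mul_assoc, symp_inv_mul, Matrix.mul_one, ← mulVec_mulVec, hv]

theorem sympConj_neg (ψ : symplecticGroup (Fin n) ℝ) (S : AntiInv n) :
    sympConj ψ (-S) = -sympConj ψ S := by
  apply Subtype.ext
  change ψ.1 * (-S.1) * (ψ⁻¹).1 = -(ψ.1 * S.1 * (ψ⁻¹).1)
  simp

theorem fixSpace_sympConj_antiParam (ψ : symplecticGroup (Fin n) ℝ) (C D : SymMat n) :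
    fixSpace (sympConj ψ (antiParam (C, D))) = lagParam ψ C := by
  rw [fixSpace_sympConj, fixSpace_antiParam, lagParam]

end TangentForm

/-! ### Fibres of the fixed space map and the bijection with the tangent bundle. -/

section TangentBundle

variable {n : ℕ}

theorem sympImage_inv_lagParam (ψ : symplecticGroup (Fin n) ℝ) (C : SymMat n) :
    sympImage ψ⁻¹ (lagParam ψ C) = stdGraph C := by
  rw [lagParam, ← sympImage_mul, inv_mul_cancel, sympImage_one]

theorem toBlocks₁₁_eq_one_of_fixSpace {S : AntiInv n} (h : fixSpace S = stdGraph 0) :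
    S.1.toBlocks₁₁ = 1 := by
  have h1 : S.1 * graphMat (0 : SymMat n) = graphMat 0 := by
    refine ext_of_mulVec_single fun i => ?_
    rw [← mulVec_mulVec, ← mem_fixSpace, h, mem_stdGraph_iff_exists]
    exact ⟨_, rfl⟩
  conv_lhs at h1 => rw [← fromBlocks_toBlocks S.1]
  rw [graphMat, fromBlocks_mul_fromRows, map_zero] at h1
  simpa using (fromRows_inj h1).1

/-- The chart of `ψ` contains the whole fibre over `ψ(ℝⁿ ⊕ 0)`: there the upper left block of `ψ⁻¹ S
ψ` is 1, and 1 + 1 is invertible. -/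
theorem mem_antiChart_source {ψ : symplecticGroup (Fin n) ℝ} {S : AntiInv n}
    (h : fixSpace S = lagParam ψ 0) : S ∈ (antiChart ψ).source := by
  have h1 : (sympConj ψ⁻¹ S).1.toBlocks₁₁ = 1 :=
    toBlocks₁₁_eq_one_of_fixSpace (by rw [fixSpace_sympConj, h, sympImage_inv_lagParam])
  change (1 + (sympConj ψ⁻¹ S).1.toBlocks₁₁).det ≠ 0
  rw [h1, ← two_smul ℝ (1 : Matrix (Fin n) (Fin n) ℝ), det_smul, det_one]
  positivity

/-- Over the centre `C = 0` the condition on `2 - D C` excludes no `D`. -/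
theorem mem_antiChart_target (ψ : symplecticGroup (Fin n) ℝ) (D : SymMat n) :
    ((0, D) : SymMat n × SymMat n) ∈ (antiChart ψ).target := by
  change (2 • (1 : Matrix (Fin n) (Fin n) ℝ) - D.toMat * (0 : SymMat n).toMat).det ≠ 0
  rw [map_zero, Matrix.mul_zero, sub_zero, ← Nat.cast_smul_eq_nsmul ℝ, det_smul, det_one]
  positivity

theorem fixSpace_eq_of_mem_source {ψ : symplecticGroup (Fin n) ℝ} {S : AntiInv n}
    (h : S ∈ (antiChart ψ).source) : fixSpace S = lagParam ψ (antiChart ψ S).1 := by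
  conv_lhs => rw [← (antiChart ψ).left_inv h]
  exact fixSpace_sympConj_antiParam _ _ _

theorem exists_eq_sympConj_antiParam {ψ : symplecticGroup (Fin n) ℝ} {S : AntiInv n}
    (h : fixSpace S = lagParam ψ 0) : ∃ D, S = sympConj ψ (antiParam (0, D)) := by
  have hs := mem_antiChart_source h
  have h0 : (antiChart ψ S).1 = 0 :=
    lagParam_injective ψ (by rw [← fixSpace_eq_of_mem_source hs, h])
  exact ⟨(antiChart ψ S).2, by rw [← h0]; exact ((antiChart ψ).left_inv hs).symm⟩

/-- The symmetric matrix `D` for which the anti-symplectic involution with coordinates `(C, D)`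
has the tangent form `X`. -/
def tanInv (ψ : symplecticGroup (Fin n) ℝ) (C X : SymMat n) : SymMat n :=
  (2 : ℝ) • symCongr (gramMat (lagFrame ψ C))⁻¹
    (tanForm (sympConj ψ (antiParam (C, 0))) (lagFrame ψ C) - X)

theorem tanForm_tanInv (ψ : symplecticGroup (Fin n) ℝ) (C X : SymMat n) :
    tanForm (sympConj ψ (antiParam (C, tanInv ψ C X))) (lagFrame ψ C) = X := by
  have hN := isUnit_iff_ne_zero.mpr (det_gramMat_lagFrame_ne_zero ψ C)
  have h : symCongr (gramMat (lagFrame ψ C)) (tanInv ψ C X) =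
      (2 : ℝ) • (tanForm (sympConj ψ (antiParam (C, 0))) (lagFrame ψ C) - X) := by
    rw [tanInv]
    refine ((symCongrEquiv _ (det_gramMat_lagFrame_ne_zero ψ C)).map_smul _ _).trans ?_
    change (2 : ℝ) • symCongr _ (symCongr _ _) = _
    rw [symCongr_mul, nonsing_inv_mul _ hN, symCongr_one]
  rw [tanForm_sympConj_antiParam, h]
  module

/-- Since `tanInv` is a right inverse by `tanForm_tanInv`, injectivity of the form as a function of
`D` is enough. -/
theorem tanInv_tanForm (ψ : symplecticGroup (Fin n) ℝ) (C D : SymMat n) :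
    tanInv ψ C (tanForm (sympConj ψ (antiParam (C, D))) (lagFrame ψ C)) = D := by
  have hN := det_gramMat_lagFrame_ne_zero ψ C
  have h := tanForm_tanInv ψ C (tanForm (sympConj ψ (antiParam (C, D))) (lagFrame ψ C))
  rw [tanForm_sympConj_antiParam, tanForm_sympConj_antiParam ψ C D, sub_right_inj] at h
  rw [tanForm_sympConj_antiParam ψ C D]
  exact symCongr_injective hN (smul_right_injective _ (by norm_num : (1 / 2 : ℝ) ≠ 0) h)

/-- A linear symplectic map which sends `ℝⁿ ⊕ 0` to `L` and defines the preferred chart at `L`. -/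
def lagBase (L : LagGr n) : symplecticGroup (Fin n) ℝ := (exists_symp_of_lagrangian L).choose

theorem lagParam_lagBase (L : LagGr n) : lagParam (lagBase L) 0 = L :=
  (exists_symp_of_lagrangian L).choose_spec

theorem extChartAt_lagGr (L : LagGr n) :
    extChartAt 𝓘(ℝ, SymMat n) L = lagChart (lagBase L) := by
  rw [extChartAt, OpenPartialHomeomorph.extend]
  exact PartialEquiv.trans_refl _

/-! ### Tangent vectors transform like bilinear forms. -/

theorem hasDerivAt_matrix {k l : Type*} [Fintype k] [Fintype l] {f : ℝ → Matrix k l ℝ}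
    {f' : Matrix k l ℝ} {t : ℝ} :
    HasDerivAt f f' t ↔ ∀ i j, HasDerivAt (fun s => f s i j) (f' i j) t := by
  have h : HasDerivAt f f' t ↔ ∀ i, HasDerivAt (fun s => f s i) (f' i) t :=
    hasDerivAt_pi (E' := fun _ => l → ℝ)
  rw [h]
  exact forall_congr' fun i => hasDerivAt_pi

theorem hasDerivAt_matrix_mul {k l m : Type*} [Fintype k] [Fintype l] [Fintype m]
    {f : ℝ → Matrix k l ℝ} {f' : Matrix k l ℝ} {g : ℝ → Matrix l m ℝ} {g' : Matrix l m ℝ} {t : ℝ}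
    (hf : HasDerivAt f f' t) (hg : HasDerivAt g g' t) :
    HasDerivAt (fun s => f s * g s) (f' * g t + f t * g') t := by
  rw [hasDerivAt_matrix] at *
  intro i j
  simp only [Matrix.mul_apply, Matrix.add_apply, ← Finset.sum_add_distrib]
  exact HasDerivAt.fun_sum fun a _ => (hf i a).mul (hg a j)

theorem hasDerivAt_graphMat {C : ℝ → SymMat n} {C' : SymMat n} {t : ℝ} (h : HasDerivAt C C' t) :
    HasDerivAt (fun s => graphMat (C s)) (fromRows (0 : Matrix (Fin n) (Fin n) ℝ) C'.toMat) t := by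
  have h1 : HasDerivAt (fun s => (C s).toMat) C'.toMat t :=
    (symSubmodule n).subtypeL.hasFDerivAt.comp_hasDerivAt t h
  rw [hasDerivAt_matrix] at h1 ⊢
  rintro (i | i) j
  · exact hasDerivAt_const _ _
  · exact h1 i j

theorem lagFrame_isotropic (ψ : symplecticGroup (Fin n) ℝ) (C : SymMat n) :
    (lagFrame ψ C)ᵀ * J (Fin n) ℝ * lagFrame ψ C = 0 := by
  have h : (lagFrame ψ C)ᵀ * J (Fin n) ℝ * lagFrame ψ C =
      (graphMat C)ᵀ * (ψ.1ᵀ * J (Fin n) ℝ * ψ.1) * graphMat C := by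
    simp only [lagFrame, transpose_mul, Matrix.mul_assoc]
  rw [h, SymplecticGroup.mem_iff'.mp ψ.2, graphMat, transpose_fromRows, Matrix.J,
    fromCols_mul_fromBlocks, fromCols_mul_fromRows, C.transpose_toMat]
  simp

/-- Pairing the frame, through `J`, with its own velocity recovers the velocity `X` in the chart up
to sign. This identifies `X` with a bilinear form on the Lagrangian subspace. -/
theorem lagFrame_J_mul (ψ : symplecticGroup (Fin n) ℝ) (C X : SymMat n) :
    (lagFrame ψ C)ᵀ * J (Fin n) ℝ * (ψ.1 * fromRows (0 : Matrix (Fin n) (Fin n) ℝ) X.toMat) = -X.toMat := by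
  have h : (lagFrame ψ C)ᵀ * J (Fin n) ℝ * (ψ.1 * fromRows (0 : Matrix (Fin n) (Fin n) ℝ) X.toMat) =
      (graphMat C)ᵀ * (ψ.1ᵀ * J (Fin n) ℝ * ψ.1) * fromRows (0 : Matrix (Fin n) (Fin n) ℝ) X.toMat := by
    simp only [lagFrame, transpose_mul, Matrix.mul_assoc]
  rw [h, SymplecticGroup.mem_iff'.mp ψ.2, graphMat, transpose_fromRows, Matrix.J,
    fromCols_mul_fromBlocks, fromCols_mul_fromRows]
  simp

/-- Differentiate the identity between the two frames along `B + t X` and pair the result with the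
frame through `J`. The term containing the derivative of the base change matrix is a combination of
frame vectors, so isotropy removes it, and `lagFrame_J_mul` evaluates what remains. -/
theorem symCongr_fderiv_transition {ψ φ : symplecticGroup (Fin n) ℝ} {B C : SymMat n}
    (h : lagParam ψ B = lagParam φ C) (X : SymMat n) :
    symCongr (frameChange (φ⁻¹ * ψ) B) (fderiv ℝ (lagChart φ ∘ (lagChart ψ).symm) B X) = X := by
  set T : SymMat n → SymMat n := lagChart φ ∘ (lagChart ψ).symm with hT
  set U := ((lagChart ψ).symm.trans (lagChart φ)).source with hU
  have hUo : IsOpen U := (lagChartedSpaceCore n).open_source _ _ (mem_range_self ψ)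
    (mem_range_self φ)
  have hBU : B ∈ U := ⟨mem_univ _, C, h.symm⟩
  have hTU : ∀ A ∈ U, lagParam ψ A = lagParam φ (T A) := fun A hA =>
    ((lagChart φ).left_inv hA.2).symm
  have hTB : T B = C := lagParam_injective φ (by rw [← hTU B hBU, h])
  have hd : HasFDerivAt T (fderiv ℝ T B) B :=
    (((lagTransition_contDiffOn ψ φ).contDiffAt (hUo.mem_nhds hBU)).differentiableAt
      (by simp)).hasFDerivAt
  have hc : HasDerivAt (fun t : ℝ => B + t • X) X 0 := by
    simpa using HasDerivAt.const_add B ((hasDerivAt_id (0 : ℝ)).smul_const X)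
  have hTc : HasDerivAt (fun t : ℝ => T (B + t • X)) (fderiv ℝ T B X) 0 := by
    have hd0 : HasFDerivAt T (fderiv ℝ T B) (B + (0 : ℝ) • X) := by simpa using hd
    exact hd0.comp_hasDerivAt (0 : ℝ) hc
  have hl : HasDerivAt (fun t : ℝ => lagFrame ψ (B + t • X)) (ψ.1 * fromRows (0 : Matrix (Fin n) (Fin n) ℝ) X.toMat) 0 := by
    simpa [lagFrame] using hasDerivAt_matrix_mul (hasDerivAt_const (0 : ℝ) ψ.1) (hasDerivAt_graphMat hc)
  have hr : HasDerivAt (fun t : ℝ => lagFrame φ (T (B + t • X)))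
      (φ.1 * fromRows (0 : Matrix (Fin n) (Fin n) ℝ) (fderiv ℝ T B X).toMat) 0 := by
    simpa [lagFrame] using hasDerivAt_matrix_mul (hasDerivAt_const (0 : ℝ) φ.1) (hasDerivAt_graphMat hTc)
  have hXm : HasDerivAt (fun t : ℝ => (B + t • X).toMat) X.toMat 0 :=
    (symSubmodule n).subtypeL.hasFDerivAt.comp_hasDerivAt (0 : ℝ) hc
  have hp : HasDerivAt (fun t : ℝ => frameChange (φ⁻¹ * ψ) (B + t • X))
      ((φ⁻¹ * ψ).1.toBlocks₁₂ * X.toMat) 0 := by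
    have h5 := hasDerivAt_matrix_mul
      (hasDerivAt_const (0 : ℝ) (φ⁻¹ * ψ).1.toBlocks₁₂) hXm
    rw [Matrix.zero_mul, zero_add] at h5
    exact h5.const_add _
  -- The frame identity is available only where both charts are defined, hence for small `t`.
  have hev : (fun t : ℝ => lagFrame ψ (B + t • X)) =ᶠ[nhds 0]
      fun t => lagFrame φ (T (B + t • X)) * frameChange (φ⁻¹ * ψ) (B + t • X) := by
    have h1 : ∀ᶠ t : ℝ in nhds 0, B + t • X ∈ U :=
      hc.continuousAt.eventually_mem (hUo.mem_nhds (by simpa using hBU))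
    filter_upwards [h1] with t ht
    exact lagFrame_eq_mul_frameChange (hTU _ ht)
  have heq := hl.unique ((hasDerivAt_matrix_mul hr hp).congr_of_eventuallyEq hev)
  simp only [zero_smul, add_zero, hTB] at heq
  set p := frameChange (φ⁻¹ * ψ) B with hp'
  have hF : lagFrame ψ B = lagFrame φ C * p := lagFrame_eq_mul_frameChange h
  have h2 := congrArg (fun A => (lagFrame ψ B)ᵀ * J (Fin n) ℝ * A) heq
  simp only [lagFrame_J_mul] at h2
  have h3 : (lagFrame ψ B)ᵀ * J (Fin n) ℝ * (φ.1 * fromRows (0 : Matrix (Fin n) (Fin n) ℝ) (fderiv ℝ T B X).toMat * p +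
      lagFrame φ C * ((φ⁻¹ * ψ).1.toBlocks₁₂ * X.toMat)) =
      pᵀ * ((lagFrame φ C)ᵀ * J (Fin n) ℝ * (φ.1 * fromRows (0 : Matrix (Fin n) (Fin n) ℝ) (fderiv ℝ T B X).toMat)) * p +
      pᵀ * ((lagFrame φ C)ᵀ * J (Fin n) ℝ * lagFrame φ C) *
        ((φ⁻¹ * ψ).1.toBlocks₁₂ * X.toMat) := by
    rw [hF, transpose_mul]
    simp only [Matrix.mul_add, Matrix.mul_assoc]
  rw [h3, lagFrame_isotropic, lagFrame_J_mul, Matrix.mul_zero, Matrix.zero_mul, add_zero,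
    Matrix.mul_neg, Matrix.neg_mul, neg_inj] at h2
  exact SymMat.ext h2.symm

/-- A point of the tangent bundle of the Lagrangian Grassmannian, given by a Lagrangian subspace and
the coordinates of a tangent vector in the preferred chart there. -/
def tanMk (L : LagGr n) (X : SymMat n) : TangentBundle 𝓘(ℝ, SymMat n) (LagGr n) := ⟨L, X⟩

/-- The coordinates of a tangent vector in the trivialization defined by the preferred chart
at `L`. -/
def tanCoord (L : LagGr n) (q : TangentBundle 𝓘(ℝ, SymMat n) (LagGr n)) : SymMat n :=
  (trivializationAt (SymMat n) (TangentSpace 𝓘(ℝ, SymMat n)) L q).2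

theorem symCongr_tanCoord {L : LagGr n} {C : SymMat n} (L' : LagGr n) (X : SymMat n)
    (h : L' = lagParam (lagBase L) C) :
    symCongr (frameChange ((lagBase L)⁻¹ * lagBase L') 0) (tanCoord L (tanMk L' X)) = X := by
  have h0 : lagParam (lagBase L') 0 = lagParam (lagBase L) C := by rw [lagParam_lagBase, h]
  have h1 : tanCoord L (tanMk L' X) =
      fderiv ℝ (lagChart (lagBase L) ∘ (lagChart (lagBase L')).symm) 0 X := by
    rw [tanCoord, TangentBundle.trivializationAt_apply]
    -- The preferred chart is centred: `L'` is the image of the graph of 0 under `lagBase L'`.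
    have e : (chartAt (SymMat n) L').extend 𝓘(ℝ, SymMat n) L' = 0 := by
      change extChartAt 𝓘(ℝ, SymMat n) L' L' = 0
      rw [extChartAt_lagGr]
      exact (congrArg _ (lagParam_lagBase L').symm).trans
        ((lagChart (lagBase L')).right_inv (mem_univ 0))
    change fderivWithin ℝ (extChartAt 𝓘(ℝ, SymMat n) L ∘ (extChartAt 𝓘(ℝ, SymMat n) L').symm)
      (range id) ((chartAt (SymMat n) L').extend 𝓘(ℝ, SymMat n) L') X = _
    rw [e, range_id, fderivWithin_univ, extChartAt_lagGr, extChartAt_lagGr]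
  rw [h1]
  exact symCongr_fderiv_transition h0 X

theorem tanCoord_injective {L L' : LagGr n} {C : SymMat n} (h : L' = lagParam (lagBase L) C)
    {X Y : SymMat n} (hXY : tanCoord L (tanMk L' X) = tanCoord L (tanMk L' Y)) : X = Y := by
  rw [← symCongr_tanCoord L' X h, hXY, symCongr_tanCoord L' Y h]

/-- The tangent vector of the Lagrangian Grassmannian at `Fix(S)` defined by `S`. -/
def tanVec (S : AntiInv n) : TangentBundle 𝓘(ℝ, SymMat n) (LagGr n) :=
  tanMk (fixSpace S) (tanForm S (lagFrame (lagBase (fixSpace S)) 0))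

/-- The map `lagBase (fixSpace S)` is an arbitrary choice with no continuity in `S`. Because vectors
and forms obey the same base change law, this choice drops out in the trivialization at a fixed `L`,
which leaves a formula that is visibly smooth. -/
theorem tanCoord_tanVec {S : AntiInv n} {L : LagGr n} {C : SymMat n}
    (h : fixSpace S = lagParam (lagBase L) C) :
    tanCoord L (tanVec S) = tanForm S (lagFrame (lagBase L) C) := by
  have h0 : lagParam (lagBase (fixSpace S)) 0 = lagParam (lagBase L) C := by
    rw [lagParam_lagBase, h]
  refine symCongr_injective (det_frameChange_ne_zero h0) ?_
  rw [tanVec, symCongr_tanCoord _ _ h, ← tanForm_mul, ← lagFrame_eq_mul_frameChange h0]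

/-- The bijection from the space of anti-symplectic involutions to the tangent bundle of the
Lagrangian Grassmannian. -/
def tanEquiv (n : ℕ) : AntiInv n ≃ TangentBundle 𝓘(ℝ, SymMat n) (LagGr n) where
  toFun := tanVec
  invFun q := sympConj (lagBase q.proj) (antiParam (0, tanInv (lagBase q.proj) 0 q.2))
  left_inv S := by
    obtain ⟨D, hD⟩ := exists_eq_sympConj_antiParam (lagParam_lagBase (fixSpace S)).symm
    change sympConj (lagBase (fixSpace S)) (antiParam (0, tanInv (lagBase (fixSpace S)) 0
      (tanForm S (lagFrame (lagBase (fixSpace S)) 0)))) = S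
    -- The symplectic map itself depends on `S`; it is frozen so that substituting for `S` leaves it
    -- alone.
    generalize lagBase (fixSpace S) = ψ at *
    rw [hD, tanInv_tanForm]
  right_inv := by
    rintro ⟨L, X⟩
    change tanMk _ _ = tanMk L X
    have h : fixSpace (sympConj (lagBase L) (antiParam (0, tanInv (lagBase L) 0 X))) = L := by
      rw [fixSpace_sympConj_antiParam, lagParam_lagBase]
    refine (congrArg₂ tanMk h ?_ : _)
    change tanForm (sympConj (lagBase L) (antiParam (0, tanInv (lagBase L) 0 X)))
      (lagFrame (lagBase (fixSpace (sympConj (lagBase L)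
        (antiParam (0, tanInv (lagBase L) 0 X))))) 0) = X
    rw [h]
    exact tanForm_tanInv _ _ _

end TangentBundle

/-! ### Smoothness of the bijection and of its inverse. -/

section Smoothness

variable {n : ℕ}

theorem contDiffOn_matrix_transpose {E : Type*} [NormedAddCommGroup E] [NormedSpace ℝ E] {s : Set E}
    {k l : Type*} [Fintype k] [Fintype l] {f : E → Matrix k l ℝ} (hf : ContDiffOn ℝ ∞ f s) :
    ContDiffOn ℝ ∞ (fun x => (f x)ᵀ) s := by
  rw [contDiffOn_matrix] at *
  exact fun i j => hf j i

theorem contDiff_lagFrame (ψ : symplecticGroup (Fin n) ℝ) : ContDiff ℝ ∞ (lagFrame ψ) := by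
  rw [← contDiffOn_univ]
  refine contDiffOn_matrix_mul contDiffOn_const ?_
  have h : ContDiffOn ℝ ∞ (SymMat.toMat (n := n)) univ := SymMat.contDiff_toMat.contDiffOn
  rw [contDiffOn_matrix] at h ⊢
  rintro (i | i) j
  · exact contDiffOn_const
  · exact h i j

theorem contDiff_sympConj_antiParam (ψ : symplecticGroup (Fin n) ℝ) :
    ContDiff ℝ ∞ fun p : SymMat n × SymMat n => (sympConj ψ (antiParam p)).1 := by
  rw [← contDiffOn_univ]
  exact contDiffOn_matrix_mul (contDiffOn_matrix_mul contDiffOn_const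
    contDiff_antiParam.contDiffOn) contDiffOn_const

theorem contDiff_tanForm (ψ : symplecticGroup (Fin n) ℝ) :
    ContDiff ℝ ∞ fun p : SymMat n × SymMat n =>
      tanForm (sympConj ψ (antiParam p)) (lagFrame ψ p.1) := by
  rw [← contDiffOn_univ, contDiffOn_symMat]
  have hF : ContDiffOn ℝ ∞ (fun p : SymMat n × SymMat n => lagFrame ψ p.1) univ :=
    ((contDiff_lagFrame ψ).comp contDiff_fst).contDiffOn
  exact (contDiffOn_matrix_mul (contDiffOn_matrix_mul (contDiffOn_matrix_transpose hF)
    (contDiffOn_matrix_mul (contDiff_sympConj_antiParam ψ).contDiffOn contDiffOn_const))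
    hF).const_smul _

theorem contDiff_tanInv (ψ : symplecticGroup (Fin n) ℝ) :
    ContDiff ℝ ∞ fun p : SymMat n × SymMat n => tanInv ψ p.1 p.2 := by
  have hF : ContDiffOn ℝ ∞ (fun p : SymMat n × SymMat n => lagFrame ψ p.1) univ :=
    ((contDiff_lagFrame ψ).comp contDiff_fst).contDiffOn
  have hN : ContDiffOn ℝ ∞
      (fun p : SymMat n × SymMat n => (gramMat (lagFrame ψ p.1))⁻¹) univ :=
    contDiffOn_matrix_inv (contDiffOn_matrix_mul (contDiffOn_matrix_transpose hF) hF)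
      fun p _ => det_gramMat_lagFrame_ne_zero ψ p.1
  have h0 : ContDiff ℝ ∞ fun p : SymMat n × SymMat n =>
      tanForm (sympConj ψ (antiParam (p.1, 0))) (lagFrame ψ p.1) :=
    (contDiff_tanForm ψ).comp (f := fun p : SymMat n × SymMat n => (p.1, (0 : SymMat n)))
      (contDiff_fst.prodMk contDiff_const)
  have h1 : ContDiff ℝ ∞ fun p : SymMat n × SymMat n =>
      tanForm (sympConj ψ (antiParam (p.1, 0))) (lagFrame ψ p.1) - p.2 := h0.sub contDiff_snd
  rw [← contDiffOn_univ, contDiffOn_symMat]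
  have h2 := contDiffOn_matrix_mul (contDiffOn_matrix_mul (contDiffOn_matrix_transpose hN)
    (contDiffOn_symMat.mp h1.contDiffOn)) hN
  exact h2.const_smul (2 : ℝ)

theorem antiChart_mem_maximalAtlas (ψ : symplecticGroup (Fin n) ℝ) :
    antiChart ψ ∈ IsManifold.maximalAtlas 𝓘(ℝ, SymMat n × SymMat n) ∞ (AntiInv n) :=
  IsManifold.subset_maximalAtlas (mem_range_self ψ)

theorem contMDiffAt_antiChart {ψ : symplecticGroup (Fin n) ℝ} {S : AntiInv n}
    (h : S ∈ (antiChart ψ).source) :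
    ContMDiffAt 𝓘(ℝ, SymMat n × SymMat n) 𝓘(ℝ, SymMat n × SymMat n) ∞ (antiChart ψ) S :=
  contMDiffAt_of_mem_maximalAtlas (antiChart_mem_maximalAtlas ψ) h

theorem contMDiffAt_antiChart_symm {ψ : symplecticGroup (Fin n) ℝ} {p : SymMat n × SymMat n}
    (h : p ∈ (antiChart ψ).target) :
    ContMDiffAt 𝓘(ℝ, SymMat n × SymMat n) 𝓘(ℝ, SymMat n × SymMat n) ∞
      (fun p => sympConj ψ (antiParam p)) p :=
  contMDiffAt_symm_of_mem_maximalAtlas (antiChart_mem_maximalAtlas ψ) h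

theorem contMDiff_lagParam_lagBase (L : LagGr n) :
    ContMDiff 𝓘(ℝ, SymMat n) 𝓘(ℝ, SymMat n) ∞ (lagParam (lagBase L)) := by
  have h := contMDiffOn_extChartAt_symm (I := 𝓘(ℝ, SymMat n)) (n := ∞) L
  rw [extChartAt_lagGr] at h
  exact contMDiffOn_univ.mp h

theorem contMDiff_tanVec :
    ContMDiff 𝓘(ℝ, SymMat n × SymMat n) 𝓘(ℝ, SymMat n).tangent ∞ (tanVec (n := n)) := by
  -- One chart centred at `Fix(S₀)` is used for all `S` near `S₀`; base point and fibre coordinate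
  -- are treated separately.
  intro S₀
  set L := fixSpace S₀ with hL
  have hS₀ : S₀ ∈ (antiChart (lagBase L)).source :=
    mem_antiChart_source (lagParam_lagBase L).symm
  have hev : ∀ᶠ S in nhds S₀, S ∈ (antiChart (lagBase L)).source :=
    (antiChart (lagBase L)).open_source.mem_nhds hS₀
  have hc := contMDiffAt_antiChart hS₀
  rw [Bundle.contMDiffAt_totalSpace]
  constructor
  · have h1 : ContMDiffAt 𝓘(ℝ, SymMat n × SymMat n) 𝓘(ℝ, SymMat n) ∞
        (fun S => lagParam (lagBase L) (antiChart (lagBase L) S).1) S₀ :=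
      (contMDiff_lagParam_lagBase L).contMDiffAt.comp S₀
        (contDiff_fst.contMDiff.contMDiffAt.comp S₀ hc)
    refine h1.congr_of_eventuallyEq ?_
    filter_upwards [hev] with S hS
    exact fixSpace_eq_of_mem_source hS
  · have h1 : ContMDiffAt 𝓘(ℝ, SymMat n × SymMat n) 𝓘(ℝ, SymMat n) ∞
        (fun S => tanForm (sympConj (lagBase L) (antiParam (antiChart (lagBase L) S)))
          (lagFrame (lagBase L) (antiChart (lagBase L) S).1)) S₀ :=
      (contDiff_tanForm (lagBase L)).contMDiff.contMDiffAt.comp S₀ hc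
    refine h1.congr_of_eventuallyEq ?_
    filter_upwards [hev] with S hS
    refine (tanCoord_tanVec (fixSpace_eq_of_mem_source hS)).trans ?_
    congr 1
    exact ((antiChart (lagBase L)).left_inv hS).symm

/-- Near a point over `L`, the inverse is given by the smooth formula with coordinates `C` and
`tanInv` in the chart of `lagBase L`. -/
theorem contMDiff_tanEquiv_symm :
    ContMDiff 𝓘(ℝ, SymMat n).tangent 𝓘(ℝ, SymMat n × SymMat n) ∞ (tanEquiv n).symm := by
  intro q₀
  set L := q₀.proj with hL
  have hproj := Bundle.contMDiffAt_proj (n := ∞) (IB := 𝓘(ℝ, SymMat n))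
    (TangentSpace 𝓘(ℝ, SymMat n) (M := LagGr n)) (p := q₀)
  have hC : ContMDiffAt 𝓘(ℝ, SymMat n).tangent 𝓘(ℝ, SymMat n) ∞
      (fun q : TangentBundle 𝓘(ℝ, SymMat n) (LagGr n) => lagChart (lagBase L) q.proj) q₀ := by
    have h := (contMDiffAt_extChartAt (I := 𝓘(ℝ, SymMat n)) (n := ∞) (x := L)).comp q₀ hproj
    rw [extChartAt_lagGr] at h
    exact h
  have hX : ContMDiffAt 𝓘(ℝ, SymMat n).tangent 𝓘(ℝ, SymMat n) ∞ (tanCoord L) q₀ :=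
    (Bundle.contMDiffAt_totalSpace.mp contMDiffAt_id).2
  have hC₀ : lagChart (lagBase L) q₀.proj = 0 :=
    (congrArg _ (lagParam_lagBase L).symm).trans
      ((lagChart (lagBase L)).right_inv (mem_univ 0))
  have hD := (contDiff_tanInv (lagBase L)).contMDiff.contMDiffAt.comp q₀ (hC.prodMk_space hX)
  have h1 : ContMDiffAt 𝓘(ℝ, SymMat n).tangent 𝓘(ℝ, SymMat n × SymMat n) ∞
      (fun q => sympConj (lagBase L) (antiParam (lagChart (lagBase L) q.proj,
        tanInv (lagBase L) (lagChart (lagBase L) q.proj) (tanCoord L q)))) q₀ := by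
    refine ContMDiffAt.comp q₀ (contMDiffAt_antiChart_symm ?_) (hC.prodMk_space hD)
    -- The chart of involutions covers only part of the fibres with `C ≠ 0`, but at `q₀` itself `C =
    -- 0`, so every `D` is allowed.
    rw [hC₀]
    exact mem_antiChart_target _ _
  refine h1.congr_of_eventuallyEq ?_
  have hev : ∀ᶠ q : TangentBundle 𝓘(ℝ, SymMat n) (LagGr n) in nhds q₀,
      q.proj ∈ (chartAt (SymMat n) L).source :=
    hproj.continuousAt.eventually_mem
      ((chartAt (SymMat n) L).open_source.mem_nhds (mem_chart_source _ L))
  filter_upwards [hev] with q hq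
  rw [Equiv.symm_apply_eq]
  have hq' : q.proj = lagParam (lagBase L) (lagChart (lagBase L) q.proj) :=
    ((lagChart (lagBase L)).left_inv hq).symm
  set C := lagChart (lagBase L) q.proj
  set S := sympConj (lagBase L) (antiParam (C, tanInv (lagBase L) C (tanCoord L q))) with hS
  have hfix : fixSpace S = lagParam (lagBase L) C := fixSpace_sympConj_antiParam _ _ _
  have ht : tanCoord L (tanVec S) = tanCoord L q := by
    rw [tanCoord_tanVec hfix, hS, tanForm_tanInv]
  have hqS : fixSpace S = q.proj := hfix.trans hq'.symm
  -- Both vectors lie over the same Lagrangian subspace and have equal coordinates in the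
  -- trivialization at `L`.
  change q = tanMk (fixSpace S) _
  change tanCoord L (tanMk (fixSpace S) _) = _ at ht
  rw [hqS] at ht ⊢
  exact congrArg (tanMk q.proj) (tanCoord_injective hq' ht).symm

/-- The diffeomorphism from the space of anti-symplectic involutions to the tangent bundle of the
Lagrangian Grassmannian. -/
def tanDiffeomorph (n : ℕ) :
    AntiInv n ≃ₘ⟮𝓘(ℝ, SymMat n × SymMat n), 𝓘(ℝ, SymMat n).tangent⟯
      TangentBundle 𝓘(ℝ, SymMat n) (LagGr n) where
  toEquiv := tanEquiv n
  contMDiff_toFun := contMDiff_tanVec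
  contMDiff_invFun := contMDiff_tanEquiv_symm

end Smoothness

/-! ### Unitary frames and the parametrisation of a fibre by graphs over `J L`. -/

section Orthonormal

variable {n : ℕ}

/-- An orthonormal frame of a Lagrangian subspace gives rise to a linear symplectic map which
commutes with the complex structure. -/
theorem exists_unitary_of_orthonormal {L : LagGr n} {u : Fin n → StdSpace n}
    (hu : ∀ i, u i ∈ L.carrier) (ho : ∀ i j, u i ⬝ᵥ u j = if i = j then 1 else 0) :
    ∃ U : symplecticGroup (Fin n) ℝ, lagParam U 0 = L ∧ U.1ᵀ * U.1 = 1 ∧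
      (∀ i, U.1.col (Sum.inl i) = u i) ∧
      ∀ i, U.1.col (Sum.inr i) = J (Fin n) ℝ *ᵥ u i := by
  let P : Matrix (Fin n) (Fin n) ℝ := Matrix.of fun i j => u j (Sum.inl i)
  let Q : Matrix (Fin n) (Fin n) ℝ := Matrix.of fun i j => u j (Sum.inr i)
  -- `h1` and `h2` are the real and imaginary parts of the statement that `P + iQ` is unitary: the
  -- first is orthonormality, the second is `ω = 0` on `L`.
  have h1 : Pᵀ * P + Qᵀ * Q = 1 := by
    ext i j
    have := ho i j
    simpa [Matrix.mul_apply, P, Q, dotProduct, Fintype.sum_sum_type, Matrix.one_apply] using this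
  have h2 : Qᵀ * P = Pᵀ * Q := by
    ext i j
    have := (L.isLagrangian (u i)).mp (hu i) (u j) (hu j)
    simp only [stdOmega, Finset.sum_sub_distrib] at this
    simp only [Matrix.mul_apply, P, Q, transpose_apply, of_apply]
    linarith
  have hm : fromBlocks P (-Q) Q P ∈ symplecticGroup (Fin n) ℝ := by
    rw [symplectic_fromBlocks_iff]
    exact ⟨h2, by simpa using h1, by simp [h2]⟩
  have hl : ∀ i, (fromBlocks P (-Q) Q P).col (Sum.inl i) = u i := by
    intro i
    ext (k | k) <;> simp [P, Q]
  refine ⟨⟨_, hm⟩, LagGr.ext (IsLagrangian.eq_of_le (lagParam _ _).isLagrangian L.isLagrangian ?_),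
    ?_, hl, ?_⟩
  · intro v hv
    obtain ⟨x, rfl⟩ := (mem_lagParam_iff_exists _ _ _).mp hv
    rw [lagFrame, ← mulVec_mulVec, graphMat_mulVec, map_zero, zero_mulVec, mulVec_eq_sum,
      Fintype.sum_sum_type]
    refine L.carrier.add_mem (L.carrier.sum_mem fun j _ => ?_) (L.carrier.sum_mem fun j _ => ?_)
    · rw [Sum.elim_inl, op_smul_eq_smul]
      exact L.carrier.smul_mem _ ((congrArg (· ∈ L.carrier) (hl j)).mpr (hu j))
    · simp
  · rw [fromBlocks_transpose, fromBlocks_multiply, ← fromBlocks_one, fromBlocks_inj]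
    refine ⟨h1, ?_, ?_, ?_⟩
    · simp [h2]
    · simp [h2]
    · simpa [add_comm] using h1
  · intro i
    ext (k | k) <;>
      simp [P, Q, Matrix.J, fromBlocks_mulVec, neg_mulVec]

/-- Substitute `J = Uᵀ J U` on the right and cancel `U Uᵀ = 1`. -/
theorem J_mul_eq_mul_J_of_orthogonal {U : symplecticGroup (Fin n) ℝ} (hU : U.1ᵀ * U.1 = 1) :
    J (Fin n) ℝ * U.1 = U.1 * J (Fin n) ℝ := by
  have h := SymplecticGroup.mem_iff'.mp U.2
  have hU' : U.1 * U.1ᵀ = 1 := mul_eq_one_comm.mp hU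
  conv_rhs => rw [← h]
  rw [← Matrix.mul_assoc, ← Matrix.mul_assoc, hU', Matrix.one_mul]

/-- As `U` is orthogonal and commutes with `J`, it drops out, and the form is `-1/2` times the upper
left block of `(1 D; 0 -1) J`, which is `D`. In particular there is no constant term. -/
theorem tanForm_of_orthogonal {U : symplecticGroup (Fin n) ℝ} (hU : U.1ᵀ * U.1 = 1)
    (D : SymMat n) :
    tanForm (sympConj U (antiParam (0, D))) (lagFrame U 0) = -(1 / 2 : ℝ) • D := by
  apply SymMat.ext
  rw [toMat_tanForm, map_smul]
  congr 1
  simp only [sympConj, lagFrame, transpose_mul]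
  have h : (graphMat (0 : SymMat n))ᵀ * U.1ᵀ *
      (U.1 * (antiParam (0, D)).1 * (U⁻¹).1 * J (Fin n) ℝ) * (U.1 * graphMat (0 : SymMat n)) =
      (graphMat (0 : SymMat n))ᵀ * (U.1ᵀ * U.1) * (antiParam (0, D)).1 *
        ((U⁻¹).1 * (J (Fin n) ℝ * U.1)) * graphMat (0 : SymMat n) := by
    simp only [Matrix.mul_assoc]
  rw [h, hU, J_mul_eq_mul_J_of_orthogonal hU, ← Matrix.mul_assoc (U⁻¹).1, symp_inv_mul,
    Matrix.mul_one, Matrix.one_mul, graphMat, transpose_fromRows, Matrix.J]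
  simp only [antiParam]
  rw [fromCols_mul_fromBlocks, fromCols_mul_fromBlocks, fromCols_mul_fromRows]
  simp

theorem mem_fixSpace_neg_antiParam_zero (D : SymMat n) (v : StdSpace n) :
    v ∈ (fixSpace (-antiParam (0, D))).carrier ↔
      (2 : ℝ) • (fun i => v (Sum.inl i)) = -(D.toMat *ᵥ fun i => v (Sum.inr i)) := by
  have h : v = Sum.elim (fun i => v (Sum.inl i)) (fun i => v (Sum.inr i)) := by
    ext (i | i) <;> rfl
  rw [mem_fixSpace_neg]
  generalize (fun i => v (Sum.inl i)) = x at *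
  generalize (fun i => v (Sum.inr i)) = y at *
  subst h
  have h1 : (antiParam (0, D)).1 *ᵥ Sum.elim x y = Sum.elim (x + D.toMat *ᵥ y) (-y) := by
    simp [antiParam, fromBlocks_mulVec, Function.comp_def, neg_mulVec]
  have h2 : -Sum.elim x y = Sum.elim (-x) (-y) := by
    ext (i | i) <;> rfl
  rw [h1, h2, Sum.elim_eq_iff]
  simp only [and_true]
  rw [two_smul]
  constructor
  · intro h
    linear_combination (exp := 1) h
  · intro h
    linear_combination (exp := 1) h

theorem fixSpace_neg_eq_range {u : Fin n → StdSpace n}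
    {U : symplecticGroup (Fin n) ℝ} (hl : ∀ i, U.1.col (Sum.inl i) = u i)
    (hr : ∀ i, U.1.col (Sum.inr i) = J (Fin n) ℝ *ᵥ u i) (B : SymMat n) :
    ((fixSpace (-sympConj U (antiParam (0, (-2 : ℝ) • B)))).carrier : Set (StdSpace n)) =
      Set.range fun y : Fin n → ℝ =>
        ∑ i, (y i • (J (Fin n) ℝ *ᵥ u i) + (B.toMat *ᵥ y) i • u i) := by
  have hU : ∀ y : Fin n → ℝ, U.1 *ᵥ Sum.elim (B.toMat *ᵥ y) y =
      ∑ i, (y i • (J (Fin n) ℝ *ᵥ u i) + (B.toMat *ᵥ y) i • u i) := by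
    intro y
    have hl' : ∀ i, U.1ᵀ (Sum.inl i) = u i := hl
    have hr' : ∀ i, U.1ᵀ (Sum.inr i) = J (Fin n) ℝ *ᵥ u i := hr
    rw [mulVec_eq_sum, Fintype.sum_sum_type, Finset.sum_add_distrib, add_comm]
    simp only [Sum.elim_inl, Sum.elim_inr, op_smul_eq_smul, hr', hl']
  have hm : ∀ v, v ∈ (fixSpace (-antiParam (0, (-2 : ℝ) • B))).carrier ↔
      ∃ y, v = Sum.elim (B.toMat *ᵥ y) y := by
    intro v
    rw [mem_fixSpace_neg_antiParam_zero, map_smul, smul_mulVec, neg_smul, neg_neg,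
      smul_right_inj (two_ne_zero (α := ℝ))]
    constructor
    · intro h
      refine ⟨fun i => v (Sum.inr i), ?_⟩
      rw [← h]
      ext (i | i) <;> rfl
    · rintro ⟨y, rfl⟩
      rfl
  rw [← sympConj_neg, fixSpace_sympConj]
  ext v
  simp only [← hU]
  constructor
  · rintro ⟨w, hw, rfl⟩
    obtain ⟨y, rfl⟩ := (hm w).mp hw
    exact ⟨y, rfl⟩
  · rintro ⟨y, rfl⟩
    exact ⟨_, (hm _).mpr ⟨y, rfl⟩, rfl⟩

/-- The affine parametrisation by symmetric matrices of the anti-symplectic involutions with a given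
fixed space. -/
def fibreEquiv {L : LagGr n} {U : symplecticGroup (Fin n) ℝ} (hL : lagParam U 0 = L) :
    SymMat n ≃ {S : AntiInv n // fixSpace S = L} where
  -- With `D = -2 B` the equation `2 x = -D y` of the second eigenspace becomes `x = B y`.
  toFun B := ⟨sympConj U (antiParam (0, (-2 : ℝ) • B)), by
    rw [fixSpace_sympConj_antiParam, hL]⟩
  invFun S := (-(1 / 2) : ℝ) • tanInv U 0 (tanForm S.1 (lagFrame U 0))
  left_inv B := by
    simp only [tanInv_tanForm]
    module
  right_inv S := by
    obtain ⟨D, hD⟩ := exists_eq_sympConj_antiParam (S.2.trans hL.symm)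
    apply Subtype.ext
    simp only
    rw [hD, tanInv_tanForm, smul_smul]
    norm_num

end Orthonormal

end

/-! ### Assembly of the theorem. -/

theorem mainTheorem3 (n : ℕ) :
    (∀ S : AntiInv n, IsCompl (fixSpace S).carrier (fixSpace (-S)).carrier) ∧
    (∀ L M : LagGr n, IsCompl L.carrier M.carrier →
      ∃! S : AntiInv n, fixSpace S = L ∧ fixSpace (-S) = M) ∧
    ∃ Φ : AntiInv n ≃ₘ⟮𝓘(ℝ, SymMat n × SymMat n), 𝓘(ℝ, SymMat n).tangent⟯
        TangentBundle 𝓘(ℝ, SymMat n) (LagGr n),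
      (∀ S : AntiInv n, (Φ S).proj = fixSpace S) ∧
      ∀ (L : LagGr n) (u : Fin n → StdSpace n), (∀ i, u i ∈ L.carrier) →
        (∀ i j, u i ⬝ᵥ u j = if i = j then 1 else 0) →
        ∃ σ : SymMat n ≃ {S : AntiInv n // fixSpace S = L},
          (∀ B : SymMat n, ((fixSpace (-(σ B).1)).carrier : Set (StdSpace n)) =
            Set.range fun y : Fin n → ℝ =>
              ∑ i, (y i • (Matrix.J (Fin n) ℝ *ᵥ u i) + (B.toMat *ᵥ y) i • u i)) ∧
          ContMDiff 𝓘(ℝ, SymMat n) 𝓘(ℝ, SymMat n × SymMat n) ∞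
            (fun B : SymMat n => (σ B).1) ∧
          ∃ ℓ : SymMat n ≃ₗ[ℝ] TangentSpace 𝓘(ℝ, SymMat n) L,
            ∀ B : SymMat n, Φ (σ B).1 = ⟨L, ℓ B⟩ := by
  refine ⟨isCompl_fixSpace, fun L M h => ?_, tanDiffeomorph n, fun S => rfl, fun L u hu ho => ?_⟩
  · obtain ⟨S, h1, h2⟩ := exists_antiInv_of_isCompl h
    exact ⟨S, ⟨h1, h2⟩, fun T hT =>
      antiInv_eq_of_fixSpace (hT.1.trans h1.symm) (hT.2.trans h2.symm)⟩
  · obtain ⟨U, hUL, hU, hl, hr⟩ := exists_unitary_of_orthonormal hu ho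
    have hLU : lagParam (lagBase L) 0 = lagParam U 0 := by rw [lagParam_lagBase, hUL]
    -- The form attached to `B` has matrix `B` in the basis `u`, while the tangent space at `L` is
    -- read in the frame of `lagBase L`. The linear isomorphism is the congruence by the base change
    -- between the two.
    refine ⟨fibreEquiv hUL, fixSpace_neg_eq_range hl hr, fun B => ?_,
      symCongrEquiv _ (det_frameChange_ne_zero hLU), fun B => ?_⟩
    · have h : ContMDiffAt 𝓘(ℝ, SymMat n) 𝓘(ℝ, SymMat n × SymMat n) ∞
          (fun B : SymMat n => ((0, (-2 : ℝ) • B) : SymMat n × SymMat n)) B :=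
        (contDiff_const.prodMk (contDiff_id.const_smul (-2 : ℝ))).contMDiff.contMDiffAt
      exact ContMDiffAt.comp (g := fun p => sympConj U (antiParam p)) B
        (contMDiffAt_antiChart_symm (mem_antiChart_target U _)) h
    · have hfix : fixSpace (fibreEquiv hUL B).1 = L := (fibreEquiv hUL B).2
      have ht : tanForm (fibreEquiv hUL B).1 (lagFrame (lagBase L) 0) =
          symCongr (frameChange (U⁻¹ * lagBase L) 0) B := by
        rw [lagFrame_eq_mul_frameChange hLU, tanForm_mul]
        congr 1
        -- The factor `-1/2` of the form cancels the factor `-2` in the parametrisation.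
        refine (tanForm_of_orthogonal hU _).trans ?_
        module
      change tanMk _ (tanForm _ (lagFrame (lagBase (fixSpace (fibreEquiv hUL B).1)) 0)) = tanMk L _
      rw [hfix]
      exact congrArg (tanMk L) ht
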